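/- **Conventions.** Let $\mathbb M$ be a saturated model of a complete first-order (possibly multi-sorted) theory; a set of elements of $\mathbb M$ is *small* if its cardinality is less than $|\mathbb M|$. Fix a small set $A$. Types are types of finite tuples; $p(\mathbb M)$ is the set of realizations of $p$, and $p\in S(A)$ is *non-algebraic* if it contains no formula with only finitely many solutions. A relation on $p(\mathbb M)$ is *relatively $A$-definable* if it is the restriction to $p(\mathbb M)$ of an $A$-definable relation. A subset of a linear order is *left-eventual* (*right-eventual*) if it contains a non-empty initial (final) part. An *so-pair over $A$* is a pair $\mathbf p=(p,<_p)$, where $p\in S(A)$ and $<_p$ is a relatively $A$-definable (strict) linear order on $p(\mathbb M)$ such that for every formula $\phi(x)$ with parameters from $\mathbb M$, exactly one of the sets $\phi(\mathbb M)\cap p(\mathbb M)$ and $p(\mathbb M)\smallsetminus\phi(\mathbb M)$ is left-eventual, and exactly one of them is right-eventual, in $(p(\mathbb M),<_p)$. Let $\mathbf p_l$ (respectively $\mathbf p_r$) be the set of all formulas $\phi(x)$ over $\mathbb M$ such that $\phi(\mathbb M)\cap p(\mathbb M)$ is left-eventual (respectively right-eventual). For a small set $B$, an element $a$ is *left* (respectively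 *right*) *$\mathbf p$-generic over $B$* if $a$ realizes $(\mathbf p_l)_{\restriction AB}$ (respectively $(\mathbf p_r)_{\restriction AB}$); $B\triangleleft^{\mathbf p}a$ means that $a$ is right $\mathbf p$-generic over $B$. Types $p,q\in S(A)$ are *weakly orthogonal* if $p(x)\cup q(y)$ determines a complete type over $A$. So-pairs $\mathbf p=(p,<_p)$ and $\mathbf q=(q,<_q)$ over $A$ are *directly nonorthogonal*, $\delta_A(\mathbf p,\mathbf q)$, if $p,q$ are not weakly orthogonal and for all $a\models p$ and $b\models q$: $a$ is left $\mathbf p$-generic over $b$ iff $b$ is right $\mathbf q$-generic over $a$, and $a$ is right $\mathbf p$-generic over $b$ iff $b$ is left $\mathbf q$-generic over $a$. The *$\delta_A$-class* of an so-pair $\mathbf p$ over $A$ is the set of all so-pairs $\mathbf q$ over $A$ with $\delta_A(\mathbf p,\mathbf q)$. Write $a\not\perp_A b$ if $\operatorname{tp}(a/Ab)$ forks over $A$. For a set $\mathcal F$ of so-pairs over $A$, let $\mathcal F(\mathbb M)$ be the set of realizations of all types that appear in $\mathcal F$; for $a,b\in\mathcal F(\mathbb M)$ let $a\triangleleft^{\mathcal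 F}b$ mean that $a\triangleleft^{\mathbf p}b$ for some $\mathbf p=(p,<_p)\in\mathcal F$ with $b\models p$; and let $\mathcal D_{\mathcal F}=\{(a,b)\in\mathcal F(\mathbb M)^2\mid a\not\perp_A b\}$. For $p\in S(A)$ let $\mathcal D_p=\{(a,b)\in p(\mathbb M)^2\mid a\not\perp_A b\}$. A relation on $\mathcal F(\mathbb M)$ is *$A$-invariant* if whether it holds of $(a,b)$ depends only on $\operatorname{tp}(a,b/A)$. **Theorem.** Let $\mathcal F$ be a set of non-algebraic so-pairs over $A$ that is part of a $\delta_A$-class (for example, a whole $\delta_A$-class). Then there is an $A$-invariant linear order $<^{\mathcal F}$ on $\mathcal F(\mathbb M)$ such that: 1. $(\mathcal F(\mathbb M),\triangleleft^{\mathcal F})$ is a strict partial order and $(\mathcal F(\mathbb M),<^{\mathcal F})$ is a linear extension of it. 2. The relation $\mathcal D_{\mathcal F}$ and $\triangleleft^{\mathcal F}$-incomparability are the same relation; it is an equivalence relation on $\mathcal F(\mathbb M)$ with $<^{\mathcal F}$-convex classes, and the quotient $(\mathcal F(\mathbb M)/\mathcal D_{\mathcal F},<^{\mathcal F})$ is a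 dense linear order. 3. For each $p\in S(A)$ that appears in $\mathcal F$, the order $<_p:=(<^{\mathcal F})_{\restriction p(\mathbb M)}$ is relatively $A$-definable, and $\mathbf p:=(p,<_p)$ is an so-pair over $A$ that is directly nonorthogonal to all pairs from $\mathcal F$. Moreover, $(p(\mathbb M),\triangleleft^{\mathbf p},<_p,\mathcal D_p)$ is a substructure of $(\mathcal F(\mathbb M),\triangleleft^{\mathcal F},<^{\mathcal F},\mathcal D_{\mathcal F})$. Moreover, if $(\mathbf p_i=(p_i,<_i)\mid i\in I)$ is a family of pairs from $\mathcal F$ whose types $p_i$ are mutually distinct, then $<^{\mathcal F}$ with these properties can be chosen to extend each $<_i$, $i\in I$. -/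

import Mathlib

/-! ## Many-sorted first-order logic -/

/-- A first-order language with set of sorts `S`. -/
structure SortedLanguage.{u, v, w} (S : Type u) where
  /-- function symbols with given sorts of arguments and of value -/
  Functions : List S → S → Type v
  /-- relation symbols with given sorts of arguments -/
  Relations : List S → Type w

namespace SortedLanguage

universe u v w m

variable {S : Type u}

/-- Terms of sort `s` in variables indexed by `α`, the variable `i` being of sort `σ i`. -/
inductive Term (L : SortedLanguage.{u, v, w} S) {α : Type} (σ : α → S) : S → Type (max u v)
  | var (i : α) : Term L σ (σ i)
  | func {l : List S} {s : S} (f : L.Functions l s)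
      (ts : (i : Fin l.length) → Term L σ (l.get i)) : Term L σ s

/-- Formulas whose free variables are indexed by `α`, the variable `i` being of sort `σ i`.
In `all s φ` the quantified variable is `none`; it has sort `s`. The other connectives and the
existential quantifier are the usual abbreviations. -/
inductive Formula (L : SortedLanguage.{u, v, w} S) :
    {α : Type} → (α → S) → Type (max 1 u v w)
  | falsum {α : Type} {σ : α → S} : Formula L σ
  | equal {α : Type} {σ : α → S} {s : S} (t₁ t₂ : Term L σ s) : Formula L σ
  | rel {α : Type} {σ : α → S} {l : List S} (R : L.Relations l)
      (ts : (i : Fin l.length) → Term L σ (l.get i)) : Formula L σ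
  | imp {α : Type} {σ : α → S} (φ ψ : Formula L σ) : Formula L σ
  | all {α : Type} {σ : α → S} (s : S)
      (φ : Formula L (fun o : Option α => o.elim s σ)) : Formula L σ

/-- An interpretation of the symbols of `L` in the sorted universe `M`. -/
class Str (L : SortedLanguage.{u, v, w} S) (M : S → Type m) where
  funMap : ∀ {l : List S} {s : S}, L.Functions l s → ((i : Fin l.length) → M (l.get i)) → M s
  relMap : ∀ {l : List S}, L.Relations l → ((i : Fin l.length) → M (l.get i)) → Prop

/-- Tuples of elements of `M` of the sorts prescribed by `σ`. -/
abbrev Tup (M : S → Type m) {α : Type} (σ : α → S) : Type m := (i : α) → M (σ i)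

/-- Concatenation of tuples. -/
def Tup.append {M : S → Type m} {α β : Type} {σ : α → S} {τ : β → S}
    (a : Tup M σ) (b : Tup M τ) : Tup M (Sum.elim σ τ)
  | Sum.inl i => a i
  | Sum.inr j => b j

/-- The set of elements of `M` (of all sorts) that occur in a tuple. -/
def Tup.elems {M : S → Type m} {α : Type} {σ : α → S} (a : Tup M σ) : Set (Σ s, M s) :=
  Set.range fun i => ⟨σ i, a i⟩

/-- Adding a value for the variable `none`. -/
def Tup.cons {M : S → Type m} {α : Type} {σ : α → S} {s : S} (c : M s) (a : Tup M σ) :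
    Tup M (fun o : Option α => o.elim s σ)
  | none => c
  | some i => a i

variable {L : SortedLanguage.{u, v, w} S} {M : S → Type m} [L.Str M]

/-- The value of a term. -/
def Term.eval {α : Type} {σ : α → S} (a : Tup M σ) : {s : S} → L.Term σ s → M s
  | _, .var i => a i
  | _, .func f ts => Str.funMap f fun i => (ts i).eval a

/-- Satisfaction of formulas in `M`. -/
def Formula.Realize : {α : Type} → {σ : α → S} → L.Formula σ → Tup M σ → Prop
  | _, _, .falsum, _ => False
  | _, _, .equal t₁ t₂, a => t₁.eval a = t₂.eval a
  | _, _, .rel R ts, a => Str.relMap R fun i => (ts i).eval a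
  | _, _, .imp φ ψ, a => φ.Realize a → ψ.Realize a
  | _, _, .all s φ, a => ∀ c : M s, φ.Realize (Tup.cons c a)

/-- Negation. -/
def Formula.neg {α : Type} {σ : α → S} (φ : L.Formula σ) : L.Formula σ := φ.imp .falsum

/-- Finite sequences of sorts, i.e. sorts of finite tuples of variables. -/
abbrev Ctx (S : Type u) : Type u := Σ n : ℕ, Fin n → S

variable (L M) in
/-- Formulas with parameters from `M`, in the variables `σ`: an `L`-formula `φ(x, y)` with a
finite tuple of elements of `M` substituted for `y`. -/
structure PFormula {α : Type} (σ : α → S) where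
  ctx : Ctx S
  form : L.Formula (Sum.elim σ ctx.2)
  params : Tup M ctx.2

namespace PFormula

variable {α : Type} {σ : α → S}

/-- `φ` is an `L_C`-formula: its parameters are in `C`. -/
def Over (φ : PFormula L M σ) (C : Set (Σ s, M s)) : Prop := φ.params.elems ⊆ C

def Realize (φ : PFormula L M σ) (a : Tup M σ) : Prop := φ.form.Realize (a.append φ.params)

def neg (φ : PFormula L M σ) : PFormula L M σ := ⟨φ.ctx, φ.form.neg, φ.params⟩

end PFormula

/-- `a` realizes every formula of `π`. -/
def Realizes {α : Type} {σ : α → S} (a : Tup M σ) (π : Set (PFormula L M σ)) : Prop :=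
  ∀ φ ∈ π, φ.Realize a

/-- `π` is finitely satisfiable in `M`. -/
def FinSat {α : Type} {σ : α → S} (π : Set (PFormula L M σ)) : Prop :=
  ∀ s : Finset (PFormula L M σ), ↑s ⊆ π → ∃ a : Tup M σ, ∀ φ ∈ s, φ.Realize a

variable (L) in
/-- The type of `a` over `C`. -/
def tp {α : Type} {σ : α → S} (a : Tup M σ) (C : Set (Σ s, M s)) : Set (PFormula L M σ) :=
  {φ | φ.Over C ∧ φ.Realize a}

variable (L) in
/-- `a ≡ b (C)`. -/
def ElemEquiv {α : Type} {σ : α → S} (C : Set (Σ s, M s)) (a b : Tup M σ) : Prop :=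
  tp L a C = tp L b C

/-- Small sets: those of cardinality less than that of `M`. -/
def Small (C : Set (Σ s, M s)) : Prop := Cardinal.mk C < Cardinal.mk (Σ s, M s)

variable (L M) in
/-- `M` is saturated: types in finitely many variables over small sets are realized. -/
def Saturated : Prop :=
  ∀ C : Set (Σ s, M s), Small C → ∀ (x : Ctx S) (π : Set (PFormula L M x.2)),
    (∀ φ ∈ π, φ.Over C) → FinSat π → ∃ a : Tup M x.2, Realizes a π

/-! ## Forking -/

/-- The formula `φ(x, b)` divides over `A`. -/
def PFormula.Divides {α : Type} {σ : α → S} (A : Set (Σ s, M s)) (φ : PFormula L M σ) : Prop :=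
  ∃ k : ℕ, 0 < k ∧ ∃ b : ℕ → Tup M φ.ctx.2, (∀ i, ElemEquiv L A (b i) φ.params) ∧
    ∀ s : Finset ℕ, s.card = k → ¬ ∃ a : Tup M σ, ∀ i ∈ s, φ.form.Realize (a.append (b i))

/-- The set of formulas `π(x)` forks over `A`: it implies a finite disjunction of formulas with
parameters from `M`, each of which divides over `A`. -/
def Forks {α : Type} {σ : α → S} (A : Set (Σ s, M s)) (π : Set (PFormula L M σ)) : Prop :=
  ∃ t : Finset (PFormula L M σ), (∀ ψ ∈ t, ψ.Divides A) ∧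
    ∃ s : Finset (PFormula L M σ), ↑s ⊆ π ∧
      ∀ a : Tup M σ, (∀ φ ∈ s, φ.Realize a) → ∃ ψ ∈ t, ψ.Realize a

variable (L) in
/-- `a` is independent from `B` over `A`: the type of `a` over `A ∪ B` does not fork over `A`. -/
def Indep {α : Type} {σ : α → S} (A : Set (Σ s, M s)) (a : Tup M σ) (B : Set (Σ s, M s)) : Prop :=
  ¬ Forks A (tp L a (A ∪ B))

/-! ## Linear orders -/

/-- `r` is a strict linear order. -/
def IsLinear {X : Type*} (r : X → X → Prop) : Prop :=
  (∀ x, ¬ r x x) ∧ (∀ x y z, r x y → r y z → r x z) ∧ ∀ x y, r x y ∨ x = y ∨ r y x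

/-- `r` is a strict partial order. -/
def IsStrictPartial {X : Type*} (r : X → X → Prop) : Prop :=
  (∀ x, ¬ r x x) ∧ ∀ x y z, r x y → r y z → r x z

/-- `D` contains a non-empty initial part of `(X, r)`. -/
def LeftEventual {X : Type*} (r : X → X → Prop) (D : Set X) : Prop :=
  ∃ I : Set X, I ⊆ D ∧ I.Nonempty ∧ ∀ a ∈ I, ∀ b, r b a → b ∈ I

/-- `D` contains a non-empty final part of `(X, r)`. -/
def RightEventual {X : Type*} (r : X → X → Prop) (D : Set X) : Prop :=
  ∃ I : Set X, I ⊆ D ∧ I.Nonempty ∧ ∀ a ∈ I, ∀ b, r a b → b ∈ I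

/-- The classes of the relation `E` are convex with respect to `r`. -/
def HasConvexClasses {X : Type*} (r E : X → X → Prop) : Prop :=
  ∀ x a b c, E x a → E x b → r a c → r c b → E x c

/-- The relation induced by `r` on the quotient: a class is below another one if all of its
elements are below all elements of the other. -/
def quotientLT {X : Type*} (r : X → X → Prop) (E : Setoid X) (c d : Quotient E) : Prop :=
  ∀ x y : X, Quotient.mk E x = c → Quotient.mk E y = d → r x y

/-- `r` is dense. -/
def IsDense {X : Type*} (r : X → X → Prop) : Prop := ∀ x y, r x y → ∃ z, r x z ∧ r z y

/-! ## Complete types and so-pairs -/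

variable (L) in
/-- Complete types over `A` in the finite tuple of variables `x`. -/
structure CompleteType (A : Set (Σ s, M s)) (x : Ctx S) where
  formulas : Set (PFormula L M x.2)
  overA : ∀ φ ∈ formulas, φ.Over A
  finSat : FinSat formulas
  complete : ∀ φ : PFormula L M x.2, φ.Over A → φ ∈ formulas ∨ φ.neg ∈ formulas

/-- The set `p(M)` of realizations of `p`. -/
def CompleteType.locus {A : Set (Σ s, M s)} {x : Ctx S} (p : CompleteType L A x) :
    Set (Tup M x.2) := {a | Realizes a p.formulas}

/-- `p` contains no formula with only finitely many solutions. -/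
def CompleteType.NonAlgebraic {A : Set (Σ s, M s)} {x : Ctx S} (p : CompleteType L A x) : Prop :=
  ∀ φ ∈ p.formulas, {a : Tup M x.2 | φ.Realize a}.Infinite

/-- `p` and `q` are weakly orthogonal: `p(x) ∪ q(y)` determines a complete type over `A`. -/
def WeaklyOrthogonal {A : Set (Σ s, M s)} {x y : Ctx S} (p : CompleteType L A x)
    (q : CompleteType L A y) : Prop :=
  ∀ a ∈ p.locus, ∀ a' ∈ p.locus, ∀ b ∈ q.locus, ∀ b' ∈ q.locus,
    ElemEquiv L A (a.append b) (a'.append b')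

variable (L) in
/-- A pair `(p, <)`: a complete type over `A` and a binary relation on its locus. -/
structure TypeWithRel (A : Set (Σ s, M s)) where
  ctx : Ctx S
  typ : CompleteType L A ctx
  lt : typ.locus → typ.locus → Prop

namespace TypeWithRel

variable {A : Set (Σ s, M s)}

/-- The subset of `p(M)` relatively defined by `φ`. -/
def solutions (P : TypeWithRel L A) (φ : PFormula L M P.ctx.2) : Set P.typ.locus :=
  {a | φ.Realize a.1}

/-- The relation `<` is relatively `A`-definable within `p(M)`. -/
def RelDefinable (P : TypeWithRel L A) : Prop :=
  ∃ φ : PFormula L M (Sum.elim P.ctx.2 P.ctx.2), φ.Over A ∧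
    ∀ a b : P.typ.locus, P.lt a b ↔ φ.Realize (a.1.append b.1)

/-- `(p, <)` is an so-pair over `A`. -/
def IsSoPair (P : TypeWithRel L A) : Prop :=
  P.RelDefinable ∧ IsLinear P.lt ∧ ∀ φ : PFormula L M P.ctx.2,
    Xor (LeftEventual P.lt (P.solutions φ)) (LeftEventual P.lt (P.solutions φ)ᶜ) ∧
    Xor (RightEventual P.lt (P.solutions φ)) (RightEventual P.lt (P.solutions φ)ᶜ)

/-- The left globalization of `(p, <)`. -/
def left (P : TypeWithRel L A) : Set (PFormula L M P.ctx.2) :=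
  {φ | LeftEventual P.lt (P.solutions φ)}

/-- The right globalization of `(p, <)`. -/
def right (P : TypeWithRel L A) : Set (PFormula L M P.ctx.2) :=
  {φ | RightEventual P.lt (P.solutions φ)}

/-- `a` is left generic over `B`: it realizes the restriction of the left globalization
to `A ∪ B`. -/
def LeftGeneric (P : TypeWithRel L A) (B : Set (Σ s, M s)) (a : Tup M P.ctx.2) : Prop :=
  Realizes a {φ ∈ P.left | φ.Over (A ∪ B)}

/-- `a` is right generic over `B`: it realizes the restriction of the right globalization
to `A ∪ B`. -/
def RightGeneric (P : TypeWithRel L A) (B : Set (Σ s, M s)) (a : Tup M P.ctx.2) : Prop :=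
  Realizes a {φ ∈ P.right | φ.Over (A ∪ B)}

end TypeWithRel

/-- Direct nonorthogonality `δ_A`. -/
def DirectlyNonorthogonal {A : Set (Σ s, M s)} (P Q : TypeWithRel L A) : Prop :=
  ¬ WeaklyOrthogonal P.typ Q.typ ∧ ∀ a ∈ P.typ.locus, ∀ b ∈ Q.typ.locus,
    (P.LeftGeneric b.elems a ↔ Q.RightGeneric a.elems b) ∧
    (P.RightGeneric b.elems a ↔ Q.LeftGeneric a.elems b)

/-- The `δ_A`-class of the so-pair `P`. -/
def deltaClass {A : Set (Σ s, M s)} (P : TypeWithRel L A) : Set (TypeWithRel L A) :=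
  {Q | Q.IsSoPair ∧ DirectlyNonorthogonal P Q}

/-! ## Sets of so-pairs -/

section Family

variable {A : Set (Σ s, M s)}

/-- `𝓕(M)`: the set of realizations of the types that appear in `𝓕`. -/
def realizations (F : Set (TypeWithRel L A)) : Set (Σ x : Ctx S, Tup M x.2) :=
  {a | ∃ P ∈ F, ∃ a' ∈ P.typ.locus, a = ⟨P.ctx, a'⟩}

/-- A realization of a type that appears in `𝓕`, as an element of `𝓕(M)`. -/
def toRealization {F : Set (TypeWithRel L A)} {P : TypeWithRel L A} (hP : P ∈ F)
    (a : P.typ.locus) : realizations F :=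
  ⟨⟨P.ctx, a.1⟩, P, hP, a.1, a.2, rfl⟩

/-- `a` is right `𝓕`-generic over `B`. -/
def RightGenericIn (F : Set (TypeWithRel L A)) (B : Set (Σ s, M s)) (a : realizations F) : Prop :=
  ∃ P ∈ F, ∃ a' ∈ P.typ.locus, a.1 = ⟨P.ctx, a'⟩ ∧ P.RightGeneric B a'

/-- The relation `a ◁ b` on `𝓕(M)`: `b` is right `𝓕`-generic over `a`. -/
def genericLT (F : Set (TypeWithRel L A)) (a b : realizations F) : Prop :=
  RightGenericIn F a.1.2.elems b

/-- Forking dependence over `A` on `𝓕(M)`. -/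
def forkingDep (F : Set (TypeWithRel L A)) (a b : realizations F) : Prop :=
  ¬ Indep L A a.1.2 b.1.2.elems

/-- The relation `r` on `𝓕(M)` is `A`-invariant: whether it holds for a pair `(a, b)` depends only
on the type of `(a, b)` over `A`. In particular it is preserved by all automorphisms over `A`. -/
def IsInvariant (F : Set (TypeWithRel L A)) (r : realizations F → realizations F → Prop) : Prop :=
  ∀ (x y : Ctx S) (a a' : Tup M x.2) (b b' : Tup M y.2)
    (ha : ⟨x, a⟩ ∈ realizations F) (ha' : ⟨x, a'⟩ ∈ realizations F)
    (hb : ⟨y, b⟩ ∈ realizations F) (hb' : ⟨y, b'⟩ ∈ realizations F),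
    ElemEquiv L A (a.append b) (a'.append b') →
      (r ⟨⟨x, a⟩, ha⟩ ⟨⟨y, b⟩, hb⟩ ↔ r ⟨⟨x, a'⟩, ha'⟩ ⟨⟨y, b'⟩, hb'⟩)

/-- The pair `(p, r ↾ p(M))`, where `p` is the type of a pair from `𝓕` and `r` is a relation
on `𝓕(M)`. -/
def restrictTo {F : Set (TypeWithRel L A)} (r : realizations F → realizations F → Prop)
    {P : TypeWithRel L A} (hP : P ∈ F) : TypeWithRel L A where
  ctx := P.ctx
  typ := P.typ
  lt a b := r (toRealization hP a) (toRealization hP b)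

/-- `r` is an `A`-invariant linear order on `𝓕(M)` that extends the strict partial order `◁` and
has the required properties with respect to `◁`, forking dependence and the types that appear
in `𝓕`. -/
structure IsAdequateOrder (F : Set (TypeWithRel L A))
    (r : realizations F → realizations F → Prop) : Prop where
  linear : IsLinear r
  invariant : IsInvariant F r
  genericLT_partial : IsStrictPartial (genericLT F)
  extends_genericLT : ∀ a b, genericLT F a b → r a b
  dep_iff_incomparable : ∀ a b, forkingDep F a b ↔ ¬ genericLT F a b ∧ ¬ genericLT F b a
  dep_convex : HasConvexClasses r (forkingDep F)
  quotient_dense : ∃ h : Equivalence (forkingDep F),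
    IsLinear (quotientLT r ⟨forkingDep F, h⟩) ∧ IsDense (quotientLT r ⟨forkingDep F, h⟩)
  restrict_definable : ∀ (P : TypeWithRel L A) (hP : P ∈ F), (restrictTo r hP).RelDefinable
  restrict_soPair : ∀ (P : TypeWithRel L A) (hP : P ∈ F), (restrictTo r hP).IsSoPair
  restrict_direct : ∀ (P : TypeWithRel L A) (hP : P ∈ F), ∀ Q ∈ F,
    DirectlyNonorthogonal (restrictTo r hP) Q
  substructure_genericLT : ∀ (P : TypeWithRel L A) (hP : P ∈ F) (a b : P.typ.locus),
    (restrictTo r hP).RightGeneric a.1.elems b.1 ↔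
      genericLT F (toRealization hP a) (toRealization hP b)
  substructure_dep : ∀ (P : TypeWithRel L A) (hP : P ∈ F) (a b : P.typ.locus),
    ¬ Indep L A a.1 b.1.elems ↔ forkingDep F (toRealization hP a) (toRealization hP b)

end Family

end SortedLanguage

/-! Over a small set `B`, the right generic elements of an so-pair form a final part of the locus on
which the type over `A ∪ B` is constant. The left generic elements form such an initial part. If the
two parts meet for `B = b`, they cover the locus, so the type is weakly orthogonal to that of `b`
(`IsSoPair.weaklyOrthogonal`). Direct nonorthogonality forbids this and exchanges left genericity of
`a` over `b` with right genericity of `b` over `a`.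

These two facts give transitivity of `◁` (`IsSoPair.rightGeneric_trans`). Homogeneity gives
interpolation: between `a ◁ c` there is an element of any chosen so-pair
(`IsSoPair.exists_rightGeneric_between`). Interpolating makes direct nonorthogonality transitive, so
all members of `F` are directly nonorthogonal to each other and to themselves. It also makes `◁`
dense, and makes it a strict weak order: given `x ◁ y`, a third element `z` is compared with an
interpolated element of its own type (`genericLT_or_genericLT`). Hence incomparability is an
equivalence relation and the quotient is a dense linear order.

Incomparability is forking dependence (`IsSoPair.indep_iff`). A generic type extends to an
`A`-invariant global type, so it does not fork. An element that is neither left nor right generic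
over `b` is confined by its type over `Ab` to a bounded interval, and such an interval divides
because it has infinitely many disjoint conjugates.

The required order refines `◁` inside its incomparability classes. One so-pair is selected for each
type of `F`; distinct types are compared by a well-order, and elements of one type by the selected
order. Since `◁` on a locus is contained in every order of the family on that locus, the refinement
restricts there to exactly the selected order, which settles the third clause and the extension
clause. -/

namespace SortedLanguage

universe u v w m

/-! ### Substitution of terms and elimination of blocks of variables. -/

section Substitution

variable {S : Type u} {L : SortedLanguage.{u, v, w} S} {M : S → Type m} [L.Str M]

/-- Simultaneous substitution of terms for the variables of a term. -/
def Term.subst {α β : Type} {σ : α → S} {τ : β → S} (g : (j : β) → L.Term σ (τ j)) :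
    {s : S} → L.Term τ s → L.Term σ s
  | _, .var j => g j
  | _, .func f ts => .func f fun i => (ts i).subst g

theorem Term.eval_subst {α β : Type} {σ : α → S} {τ : β → S} (g : (j : β) → L.Term σ (τ j))
    (a : Tup M σ) {s : S} (t : L.Term τ s) :
    (t.subst g).eval a = t.eval (fun j => (g j).eval a) := by
  induction t with
  | var j => rfl
  | func f ts ih => simp only [Term.subst, Term.eval, ih]

/-- A substitution extended to a new variable, which is left unchanged. -/
def Term.substLift {α β : Type} {σ : α → S} {τ : β → S} (s : S)
    (g : (j : β) → L.Term σ (τ j)) :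
    (o : Option β) → L.Term (fun o : Option α => o.elim s σ) (o.elim s τ)
  | none => .var (σ := fun o : Option α => o.elim s σ) none
  | some j => (g j).subst fun i => .var (σ := fun o : Option α => o.elim s σ) (some i)

/-- Substitution of terms for the free variables of a formula. -/
def Formula.subst : {β : Type} → {τ : β → S} → L.Formula τ →
    {α : Type} → {σ : α → S} → ((j : β) → L.Term σ (τ j)) → L.Formula σ
  | _, _, .falsum, _, _, _ => .falsum
  | _, _, .equal t₁ t₂, _, _, g => .equal (t₁.subst g) (t₂.subst g)
  | _, _, .rel R ts, _, _, g => .rel R fun i => (ts i).subst g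
  | _, _, .imp φ ψ, _, _, g => .imp (φ.subst g) (ψ.subst g)
  | _, _, .all s φ, _, _, g => .all s (φ.subst (Term.substLift s g))

theorem Formula.realize_subst {β : Type} {τ : β → S} (φ : L.Formula τ) {α : Type} {σ : α → S}
    (g : (j : β) → L.Term σ (τ j)) (a : Tup M σ) :
    (φ.subst g).Realize a ↔ φ.Realize (fun j => (g j).eval a) := by
  induction φ generalizing α with
  | falsum => rfl
  | equal t₁ t₂ => simp only [Formula.subst, Formula.Realize, Term.eval_subst]
  | rel R ts => simp only [Formula.subst, Formula.Realize, Term.eval_subst]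
  | imp φ ψ ih₁ ih₂ => simp only [Formula.subst, Formula.Realize, ih₁, ih₂]
  | all s φ ih =>
    simp only [Formula.subst, Formula.Realize, ih]
    refine forall_congr' fun c => iff_of_eq (congrArg _ ?_)
    funext o
    cases o with
    | none => rfl
    | some j => exact Term.eval_subst _ _ _

theorem Formula.realize_neg {α : Type} {σ : α → S} (φ : L.Formula σ) (a : Tup M σ) :
    φ.neg.Realize a ↔ ¬ φ.Realize a := Iff.rfl

/-- Finitely many variables can be replaced by a list of variables. -/
theorem exists_listing {α : Type} [Finite α] (σ : α → S) :
    ∃ (n : ℕ) (e : Fin n → α) (g : (j : α) → L.Term (fun i => σ (e i)) (σ j)),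
      ∀ (a : Tup M σ) (j : α), (g j).eval (fun i => a (e i)) = a j := by
  obtain ⟨n, ⟨e⟩⟩ := Finite.exists_equiv_fin α
  have key : ∀ j : α, ∃ t : L.Term (fun i => σ (e.symm i)) (σ j),
      ∀ a : Tup M σ, t.eval (fun i => a (e.symm i)) = a j := by
    intro j
    -- Replacing `j` by `e.symm i` makes the sorts agree definitionally, so no cast between sorts
    -- appears.
    obtain ⟨i, rfl⟩ := e.symm.surjective j
    exact ⟨.var (σ := fun i => σ (e.symm i)) i, fun a => rfl⟩
  choose g hg using key
  exact ⟨n, e.symm, g, fun a j => hg j a⟩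

/-- Induction on the number of variables: variable `0` becomes `none` and is bound by `¬∀¬`, and the
remaining ones are left to the induction hypothesis. -/
theorem Formula.exists_projection {α : Type} {σ : α → S} {n : ℕ} (τ : Fin n → S)
    (φ : L.Formula (Sum.elim σ τ)) :
    ∃ ψ : L.Formula σ, ∀ a : Tup M σ, ψ.Realize a ↔ ∃ b : Tup M τ, φ.Realize (a.append b) := by
  induction n with
  | zero =>
    refine ⟨φ.subst (fun j => match j with
      | Sum.inl i => .var i
      | Sum.inr k => k.elim0), fun a => ?_⟩
    rw [Formula.realize_subst]
    have h : ∀ b : Tup M τ, (fun j => Term.eval a (match j with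
      | Sum.inl i => (Term.var i : L.Term σ _)
      | Sum.inr k => k.elim0)) = a.append b := by
      intro b
      funext j
      rcases j with i | k
      · rfl
      · exact k.elim0
    exact ⟨fun H => ⟨fun k => k.elim0, by rwa [← h]⟩, fun ⟨b, hb⟩ => by rwa [h b]⟩
  | succ n ih =>
    let ρ : Option (α ⊕ Fin n) → S :=
      fun o => o.elim (τ 0) (Sum.elim σ fun k : Fin n => τ k.succ)
    let g : (j : α ⊕ Fin (n + 1)) → L.Term ρ (Sum.elim σ τ j) := fun j => match j with
      | Sum.inl i => .var (σ := ρ) (some (Sum.inl i))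
      | Sum.inr k => Fin.cases (motive := fun k => L.Term ρ (τ k))
          (.var (σ := ρ) none) (fun k => .var (σ := ρ) (some (Sum.inr k))) k
    obtain ⟨ψ, hψ⟩ := ih (fun k : Fin n => τ k.succ) (Formula.all (τ 0) (φ.subst g).neg).neg
    have h : ∀ (a : Tup M σ) (b : Tup M τ),
        (fun j => (g j).eval (Tup.cons (b 0) (a.append fun k : Fin n => b k.succ))) = a.append b := by
      intro a b
      funext j
      rcases j with i | k
      · rfl
      · refine Fin.cases ?_ (fun k => ?_) k <;> rfl
    refine ⟨ψ, fun a => (hψ a).trans ?_⟩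
    simp only [Formula.realize_neg, Formula.Realize, not_forall, not_not, Formula.realize_subst]
    constructor
    · rintro ⟨b, c, hc⟩
      refine ⟨Fin.cons c b, ?_⟩
      rw [← h]
      exact hc
    · rintro ⟨b, hb⟩
      exact ⟨fun k : Fin n => b k.succ, b 0, by rw [h]; exact hb⟩

end Substitution

/-! ### Calculus of definable sets with parameters. -/

section Definable

variable {S : Type u} {L : SortedLanguage.{u, v, w} S} {M : S → Type m} [L.Str M]

variable (L) in
/-- `D` is the set of solutions of a formula with parameters in `C`. -/
def DefOver {α : Type} {σ : α → S} (C : Set (Σ s, M s)) (D : Set (Tup M σ)) : Prop :=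
  ∃ φ : PFormula L M σ, φ.Over C ∧ ∀ a, φ.Realize a ↔ a ∈ D

variable {α β : Type} {σ : α → S} {τ : β → S} {C C' : Set (Σ s, M s)} {D E : Set (Tup M σ)}

theorem PFormula.Over.defOver {φ : PFormula L M σ} (h : φ.Over C) :
    DefOver L C {a | φ.Realize a} :=
  ⟨φ, h, fun _ => Iff.rfl⟩

/-- Concatenating parameter tuples yields sum-indexed contexts, whereas `PFormula` demands `Fin n`;
relisting the variables bridges the two. -/
theorem Formula.defOver {γ : Type} [Finite γ] {ρ : γ → S} (φ : L.Formula (Sum.elim σ ρ))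
    (c : Tup M ρ) (hc : c.elems ⊆ C) : DefOver L C {a : Tup M σ | φ.Realize (a.append c)} := by
  obtain ⟨n, e, g, hg⟩ := exists_listing (L := L) (M := M) ρ
  let g' : (j : α ⊕ γ) → L.Term (Sum.elim σ fun i => ρ (e i)) (Sum.elim σ ρ j) := fun j =>
    match j with
    | Sum.inl i => .var (σ := Sum.elim σ fun i => ρ (e i)) (Sum.inl i)
    | Sum.inr k => (g k).subst fun i => .var (σ := Sum.elim σ fun i => ρ (e i)) (Sum.inr i)
  refine ⟨⟨⟨n, fun i => ρ (e i)⟩, φ.subst g', fun i => c (e i)⟩, ?_, fun a => ?_⟩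
  · rintro _ ⟨i, rfl⟩
    exact hc ⟨e i, rfl⟩
  · refine (Formula.realize_subst _ _ _).trans (iff_of_eq (congrArg _ ?_))
    funext j
    rcases j with i | k
    · rfl
    · exact (Term.eval_subst _ _ _).trans (hg c k)

theorem DefOver.mono (h : DefOver L C D) (hC : C ⊆ C') : DefOver L C' D := by
  obtain ⟨φ, hφ, H⟩ := h
  exact ⟨φ, hφ.trans hC, H⟩

theorem DefOver.compl (h : DefOver L C D) : DefOver L C Dᶜ := by
  obtain ⟨φ, hφ, H⟩ := h
  exact ⟨φ.neg, hφ, fun a => not_congr (H a)⟩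

theorem DefOver.preimage (h : DefOver L C D) (g : (i : α) → L.Term τ (σ i)) :
    DefOver L C {b : Tup M τ | (fun i => (g i).eval b) ∈ D} := by
  obtain ⟨⟨x, φ, c⟩, hφ, H⟩ := h
  let g' : (j : α ⊕ Fin x.1) → L.Term (Sum.elim τ x.2) (Sum.elim σ x.2 j) := fun j =>
    match j with
    | Sum.inl i => (g i).subst fun i => .var (σ := Sum.elim τ x.2) (Sum.inl i)
    | Sum.inr k => .var (σ := Sum.elim τ x.2) (Sum.inr k)
  refine ⟨⟨x, φ.subst g', c⟩, hφ, fun b => ?_⟩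
  refine (Formula.realize_subst _ _ _).trans (Iff.trans (iff_of_eq (congrArg _ ?_)) (H _))
  funext j
  rcases j with i | k
  · exact Term.eval_subst _ _ _
  · rfl

theorem DefOver.inter (hD : DefOver L C D) (hE : DefOver L C E) : DefOver L C (D ∩ E) := by
  obtain ⟨⟨x, φ, c⟩, hφ, H⟩ := hD
  obtain ⟨⟨y, ψ, d⟩, hψ, K⟩ := hE
  let ρ : α ⊕ (Fin x.1 ⊕ Fin y.1) → S := Sum.elim σ (Sum.elim x.2 y.2)
  let g₁ : (j : α ⊕ Fin x.1) → L.Term ρ (Sum.elim σ x.2 j) := fun j => match j with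
    | Sum.inl i => .var (σ := ρ) (Sum.inl i)
    | Sum.inr k => .var (σ := ρ) (Sum.inr (Sum.inl k))
  let g₂ : (j : α ⊕ Fin y.1) → L.Term ρ (Sum.elim σ y.2 j) := fun j => match j with
    | Sum.inl i => .var (σ := ρ) (Sum.inl i)
    | Sum.inr k => .var (σ := ρ) (Sum.inr (Sum.inr k))
  have key := Formula.defOver (C := C) ((φ.subst g₁).imp (ψ.subst g₂).neg).neg (c.append d) (by
    rintro _ ⟨i | k, rfl⟩
    · exact hφ ⟨i, rfl⟩
    · exact hψ ⟨k, rfl⟩)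
  convert key using 1
  ext a
  have h₁ : (fun j => (g₁ j).eval (a.append (c.append d))) = a.append c := by
    funext j
    rcases j with i | k <;> rfl
  have h₂ : (fun j => (g₂ j).eval (a.append (c.append d))) = a.append d := by
    funext j
    rcases j with i | k <;> rfl
  simp only [Set.mem_inter_iff, Set.mem_ofPred_eq, Formula.realize_neg, Formula.Realize,
    Formula.realize_subst, h₁, h₂, Classical.not_imp, not_not]
  rw [← H, ← K]
  rfl

theorem DefOver.univ : DefOver L C (Set.univ : Set (Tup M σ)) :=
  ⟨⟨⟨0, fun i => i.elim0⟩, Formula.neg .falsum, fun i => i.elim0⟩,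
    by rintro _ ⟨i, rfl⟩; exact i.elim0, fun _ => iff_of_true id trivial⟩

theorem DefOver.exists_tuple [Finite β] {D : Set (Tup M (Sum.elim σ τ))} (h : DefOver L C D) :
    DefOver L C {a : Tup M σ | ∃ b : Tup M τ, a.append b ∈ D} := by
  obtain ⟨n, e, g, hg⟩ := exists_listing (L := L) (M := M) τ
  obtain ⟨⟨x, φ, c⟩, hφ, H⟩ := h
  let ρ : (α ⊕ Fin x.1) ⊕ Fin n → S := Sum.elim (Sum.elim σ x.2) fun i => τ (e i)
  let g' : (j : (α ⊕ β) ⊕ Fin x.1) → L.Term ρ (Sum.elim (Sum.elim σ τ) x.2 j) := fun j =>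
    match j with
    | Sum.inl (Sum.inl i) => .var (σ := ρ) (Sum.inl (Sum.inl i))
    | Sum.inl (Sum.inr k) => (g k).subst fun i => .var (σ := ρ) (Sum.inr i)
    | Sum.inr k => .var (σ := ρ) (Sum.inl (Sum.inr k))
  obtain ⟨ψ, hψ⟩ := Formula.exists_projection (M := M) (fun i => τ (e i)) (φ.subst g')
  refine ⟨⟨x, ψ, c⟩, hφ, fun a => (hψ _).trans ?_⟩
  have key : ∀ b : Tup M fun i => τ (e i),
      (fun j => (g' j).eval ((a.append c).append b)) =
        (a.append fun k => (g k).eval b).append c := by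
    intro b
    funext j
    rcases j with (i | k) | k
    · rfl
    · exact Term.eval_subst _ _ _
    · rfl
  simp only [Formula.realize_subst, key]
  constructor
  · rintro ⟨b, hb⟩
    exact ⟨fun k => (g k).eval b, (H _).1 hb⟩
  · rintro ⟨b, hb⟩
    refine ⟨fun i => b (e i), (H _).2 ?_⟩
    have : (fun k => (g k).eval fun i => b (e i)) = b := funext fun k => hg b k
    rwa [this]

theorem DefOver.fiber [Finite β] {D : Set (Tup M (Sum.elim σ τ))} (h : DefOver L C D)
    (b : Tup M τ) : DefOver L (C ∪ b.elems) {a : Tup M σ | a.append b ∈ D} := by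
  obtain ⟨⟨x, φ, c⟩, hφ, H⟩ := h
  let ρ : α ⊕ (β ⊕ Fin x.1) → S := Sum.elim σ (Sum.elim τ x.2)
  let g : (j : (α ⊕ β) ⊕ Fin x.1) → L.Term ρ (Sum.elim (Sum.elim σ τ) x.2 j) := fun j =>
    match j with
    | Sum.inl (Sum.inl i) => .var (σ := ρ) (Sum.inl i)
    | Sum.inl (Sum.inr k) => .var (σ := ρ) (Sum.inr (Sum.inl k))
    | Sum.inr k => .var (σ := ρ) (Sum.inr (Sum.inr k))
  have key := Formula.defOver (C := C ∪ b.elems) (φ.subst g) (b.append c) (by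
    rintro _ ⟨i | k, rfl⟩
    · exact Or.inr ⟨i, rfl⟩
    · exact Or.inl (hφ ⟨k, rfl⟩))
  convert key using 1
  ext a
  refine (H _).symm.trans (Iff.trans (iff_of_eq (congrArg φ.Realize ?_))
    (Formula.realize_subst _ _ _).symm)
  funext j
  rcases j with (i | k) | k <;> rfl

/-- Converse of `DefOver.fiber`: parameters lying in `C` are kept, and each other parameter is an
entry of `b` and becomes a variable. -/
theorem DefOver.exists_fiber {b : Tup M τ} (h : DefOver L (C ∪ b.elems) D) :
    ∃ D' : Set (Tup M (Sum.elim σ τ)), DefOver L C D' ∧ ∀ a, a.append b ∈ D' ↔ a ∈ D := by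
  obtain ⟨⟨x, φ, c⟩, hφ, H⟩ := h
  let γ : Type := {k : Fin x.1 // (⟨x.2 k, c k⟩ : Σ s, M s) ∈ C}
  let c' : Tup M (fun k : γ => x.2 k.1) := fun k => c k.1
  let ρ : (α ⊕ β) ⊕ γ → S := Sum.elim (Sum.elim σ τ) fun k : γ => x.2 k.1
  have key : ∀ k : Fin x.1, ∃ t : L.Term ρ (x.2 k),
      ∀ a : Tup M σ, t.eval ((a.append b).append c') = c k := by
    intro k
    rcases hφ ⟨k, rfl⟩ with hk | hk
    · exact ⟨.var (σ := ρ) (Sum.inr ⟨k, hk⟩), fun a => rfl⟩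
    · have : ∀ z : Σ s, M s, z ∈ b.elems → ∃ t : L.Term ρ z.1,
          ∀ a : Tup M σ, t.eval ((a.append b).append c') = z.2 := by
        rintro _ ⟨j, rfl⟩
        exact ⟨.var (σ := ρ) (Sum.inl (Sum.inr j)), fun a => rfl⟩
      exact this _ hk
  choose t ht using key
  let g : (j : α ⊕ Fin x.1) → L.Term ρ (Sum.elim σ x.2 j) := fun j => match j with
    | Sum.inl i => .var (σ := ρ) (Sum.inl (Sum.inl i))
    | Sum.inr k => t k
  refine ⟨_, Formula.defOver (C := C) (φ.subst g) c' ?_, fun a => ?_⟩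
  · rintro _ ⟨k, rfl⟩
    exact k.2
  · rw [Set.mem_ofPred_eq, Formula.realize_subst, ← H]
    refine iff_of_eq (congrArg _ ?_)
    funext j
    rcases j with i | k
    · rfl
    · exact ht k a

end Definable

/-! ### Saturation: realization, homogeneity, compactness. -/

section Saturation

variable {S : Type u} {L : SortedLanguage.{u, v, w} S} {M : S → Type m} [L.Str M]
variable {α β γ : Type} {σ : α → S} {τ : β → S} {ρ : γ → S} {C C' : Set (Σ s, M s)}
  {a a' : Tup M σ} {b b' : Tup M τ} {c c' : Tup M ρ}

theorem elemEquiv_iff :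
    ElemEquiv L C a a' ↔ ∀ D : Set (Tup M σ), DefOver L C D → (a ∈ D ↔ a' ∈ D) := by
  constructor
  · rintro h D ⟨φ, hφ, H⟩
    have : φ ∈ tp L a C ↔ φ ∈ tp L a' C := by rw [show tp L a C = tp L a' C from h]
    rw [← H, ← H]
    exact ⟨fun h => (this.1 ⟨hφ, h⟩).2, fun h => (this.2 ⟨hφ, h⟩).2⟩
  · intro h
    refine Set.ext fun φ => ?_
    exact and_congr_right fun hφ => h _ (PFormula.Over.defOver hφ)

theorem ElemEquiv.refl (C : Set (Σ s, M s)) (a : Tup M σ) : ElemEquiv L C a a := Eq.refl _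

theorem ElemEquiv.symm (h : ElemEquiv L C a a') : ElemEquiv L C a' a := Eq.symm h

theorem ElemEquiv.trans {a'' : Tup M σ} (h : ElemEquiv L C a a') (h' : ElemEquiv L C a' a'') :
    ElemEquiv L C a a'' := Eq.trans h h'

theorem ElemEquiv.mem_iff (h : ElemEquiv L C a a') {D : Set (Tup M σ)} (hD : DefOver L C D) :
    a ∈ D ↔ a' ∈ D :=
  elemEquiv_iff.1 h D hD

theorem ElemEquiv.mono (h : ElemEquiv L C' a a') (hC : C ⊆ C') : ElemEquiv L C a a' :=
  elemEquiv_iff.2 fun _ hD => h.mem_iff (hD.mono hC)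

theorem ElemEquiv.eval (h : ElemEquiv L C a a') (g : (j : β) → L.Term σ (τ j)) :
    ElemEquiv L C (fun j => (g j).eval a : Tup M τ) (fun j => (g j).eval a') :=
  elemEquiv_iff.2 fun _ hD => h.mem_iff (hD.preimage g)

theorem ElemEquiv.fst (h : ElemEquiv L C (a.append b) (a'.append b')) : ElemEquiv L C a a' :=
  h.eval (τ := σ) fun i => .var (σ := Sum.elim σ τ) (Sum.inl i)

theorem ElemEquiv.snd (h : ElemEquiv L C (a.append b) (a'.append b')) : ElemEquiv L C b b' :=
  h.eval (τ := τ) fun i => .var (σ := Sum.elim σ τ) (Sum.inr i)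

theorem ElemEquiv.swap (h : ElemEquiv L C (a.append b) (a'.append b')) :
    ElemEquiv L C (b.append a) (b'.append a') := by
  have := h.eval (τ := Sum.elim τ σ) fun i => match i with
    | Sum.inl i => .var (σ := Sum.elim σ τ) (Sum.inr i)
    | Sum.inr i => .var (σ := Sum.elim σ τ) (Sum.inl i)
  convert this using 1 <;> (funext i; rcases i with i | i <;> rfl)

theorem elemEquiv_union_elems_iff [Finite β] :
    ElemEquiv L (C ∪ b.elems) a a' ↔ ElemEquiv L C (a.append b) (a'.append b) := by
  constructor
  · intro h
    exact elemEquiv_iff.2 fun D hD => h.mem_iff (hD.fiber b)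
  · intro h
    refine elemEquiv_iff.2 fun D hD => ?_
    obtain ⟨D', hD', H⟩ := hD.exists_fiber
    rw [← H, ← H]
    exact h.mem_iff hD'

theorem Tup.finite_elems [Finite α] (a : Tup M σ) : a.elems.Finite := Set.finite_range _

theorem Small.union_finite [Infinite (Σ s, M s)] (hC : Small C) {B : Set (Σ s, M s)}
    (hB : B.Finite) : Small (C ∪ B) :=
  (Cardinal.mk_union_le C B).trans_lt
    (Cardinal.add_lt_of_lt (Cardinal.aleph0_le_mk _) hC
      (hB.lt_aleph0.trans_le (Cardinal.aleph0_le_mk _)))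

theorem Saturated.exists_mem_of_directed (hM : Saturated L M) (hC : Small C) [Finite α]
    (𝒟 : Set (Set (Tup M σ))) (hne : 𝒟.Nonempty) (hdef : ∀ D ∈ 𝒟, DefOver L C D)
    (hinter : ∀ D ∈ 𝒟, ∀ E ∈ 𝒟, ∃ G ∈ 𝒟, G ⊆ D ∩ E) (hpos : ∀ D ∈ 𝒟, D.Nonempty) :
    ∃ a, ∀ D ∈ 𝒟, a ∈ D := by
  classical
  obtain ⟨n, e, g, hg⟩ := exists_listing (L := L) (M := M) σ
  let T : Tup M (fun i => σ (e i)) → Tup M σ := fun b j => (g j).eval b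
  have hT : ∀ a : Tup M σ, T (fun i => a (e i)) = a := fun a => funext fun j => hg a j
  let π : Set (PFormula L M fun i => σ (e i)) :=
    {φ | φ.Over C ∧ ∃ D ∈ 𝒟, ∀ b, φ.Realize b ↔ T b ∈ D}
  obtain ⟨b, hb⟩ := hM C hC ⟨n, fun i => σ (e i)⟩ π (fun φ h => h.1) (by
    intro s hs
    have : ∃ G ∈ 𝒟, ∀ b, T b ∈ G → ∀ φ ∈ s, φ.Realize b := by
      induction s using Finset.induction_on with
      | empty =>
        obtain ⟨G, hG⟩ := hne
        exact ⟨G, hG, by simp⟩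
      | insert φ s _ ih =>
        obtain ⟨G, hG, H⟩ := ih fun ψ h => hs (Finset.mem_insert_of_mem h)
        obtain ⟨_, E, hE, K⟩ := hs (Finset.mem_insert_self φ s)
        obtain ⟨U, hU, hUs⟩ := hinter E hE G hG
        refine ⟨U, hU, fun b hb ψ hψ => ?_⟩
        rcases Finset.mem_insert.1 hψ with rfl | hψ
        · exact (K b).2 (hUs hb).1
        · exact H b (hUs hb).2 ψ hψ
    obtain ⟨G, hG, H⟩ := this
    obtain ⟨a, ha⟩ := hpos G hG
    exact ⟨fun i => a (e i), H _ (by rwa [hT])⟩)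
  refine ⟨T b, fun D hD => ?_⟩
  obtain ⟨φ, hφ, H⟩ := (hdef D hD).preimage g
  exact (H b).1 (hb φ ⟨hφ, D, hD, H⟩)

/-- Elementary maps between tuples over small sets extend to further tuples. -/
theorem ElemEquiv.exists_append (hM : Saturated L M) [Infinite (Σ s, M s)] (hC : Small C)
    [Finite α] [Finite β] (h : ElemEquiv L C a a') (b : Tup M τ) :
    ∃ b' : Tup M τ, ElemEquiv L C (a.append b) (a'.append b') := by
  let 𝒟 : Set (Set (Tup M τ)) :=
    {E | ∃ D : Set (Tup M (Sum.elim σ τ)), DefOver L C D ∧ a.append b ∈ D ∧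
      E = {y | a'.append y ∈ D}}
  obtain ⟨b', hb'⟩ := hM.exists_mem_of_directed (hC.union_finite a'.finite_elems) 𝒟
    ⟨_, _, DefOver.univ, trivial, rfl⟩ (by
      rintro _ ⟨D, hD, -, rfl⟩
      let g : (j : β ⊕ α) → L.Term (Sum.elim τ σ) (Sum.elim τ σ j) := fun j => .var j
      let g' : (j : α ⊕ β) → L.Term (Sum.elim τ σ) (Sum.elim σ τ j) := fun j => match j with
        | Sum.inl i => .var (σ := Sum.elim τ σ) (Sum.inr i)
        | Sum.inr i => .var (σ := Sum.elim τ σ) (Sum.inl i)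
      convert (hD.preimage g').fiber a' using 1
      ext y
      refine iff_of_eq (congrArg (· ∈ D) ?_)
      funext j
      rcases j with j | j <;> rfl) (by
      rintro _ ⟨D, hD, hbD, rfl⟩ _ ⟨E, hE, hbE, rfl⟩
      exact ⟨_, ⟨D ∩ E, hD.inter hE, ⟨hbD, hbE⟩, rfl⟩, subset_rfl⟩) (by
      rintro _ ⟨D, hD, hbD, rfl⟩
      -- The projection of `D` is definable over `C` and contains `a`, hence also `a'`.
      exact (h.mem_iff hD.exists_tuple).1 ⟨b, hbD⟩)
  refine ⟨b', elemEquiv_iff.2 fun D hD => ⟨fun H => hb' _ ⟨D, hD, H, rfl⟩, fun H => ?_⟩⟩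
  by_contra hn
  exact hb' _ ⟨Dᶜ, hD.compl, hn, rfl⟩ H

/-- Compactness: a definable set that contains all realizations of a type contains the solutions
of a single formula of the type. -/
theorem Saturated.exists_mem_subset (hM : Saturated L M) (hC : Small C') (hCC : C ⊆ C')
    [Finite α] (a : Tup M σ) {U : Set (Tup M σ)} (hU : DefOver L C' U)
    (h : ∀ a', ElemEquiv L C a a' → a' ∈ U) : ∃ D, DefOver L C D ∧ a ∈ D ∧ D ⊆ U := by
  by_contra! hcon
  obtain ⟨a', ha'⟩ := hM.exists_mem_of_directed hC
    {E | ∃ D : Set (Tup M σ), DefOver L C D ∧ a ∈ D ∧ E = D ∩ Uᶜ}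
    ⟨_, _, DefOver.univ, trivial, rfl⟩
    (by
      rintro _ ⟨D, hD, -, rfl⟩
      exact (hD.mono hCC).inter hU.compl)
    (by
      rintro _ ⟨D, hD, haD, rfl⟩ _ ⟨E, hE, haE, rfl⟩
      exact ⟨_, ⟨D ∩ E, hD.inter hE, ⟨haD, haE⟩, rfl⟩,
        fun x hx => ⟨⟨hx.1.1, hx.2⟩, hx.1.2, hx.2⟩⟩)
    (by
      rintro _ ⟨D, hD, haD, rfl⟩
      obtain ⟨x, hx, hxU⟩ := Set.not_subset.1 (hcon D hD haD)
      exact ⟨x, hx, hxU⟩)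
  refine (ha' _ ⟨_, DefOver.univ, trivial, rfl⟩).2 (h a' (elemEquiv_iff.2 fun D hD => ?_))
  refine ⟨fun H => (ha' _ ⟨D, hD, H, rfl⟩).1, fun H => ?_⟩
  by_contra hn
  exact (ha' _ ⟨Dᶜ, hD.compl, hn, rfl⟩).1 H

end Saturation

/-! ### Generic elements of a single so-pair. -/

section SoPairs

variable {S : Type u} {L : SortedLanguage.{u, v, w} S} {M : S → Type m} [L.Str M]
variable {α β : Type} {σ : α → S} {τ : β → S} {A B C : Set (Σ s, M s)}

theorem CompleteType.mem_locus_of_elemEquiv {x : Ctx S} {p : CompleteType L A x}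
    {a a' : Tup M x.2} (ha : a ∈ p.locus) (h : ElemEquiv L A a a') : a' ∈ p.locus :=
  fun φ hφ => (h.mem_iff (PFormula.Over.defOver (p.overA φ hφ))).1 (ha φ hφ)

theorem CompleteType.tp_eq_formulas {x : Ctx S} {p : CompleteType L A x} {a : Tup M x.2}
    (ha : a ∈ p.locus) : tp L a A = p.formulas := by
  refine Set.ext fun φ => ⟨fun h => ?_, fun h => ⟨p.overA φ h, ha φ h⟩⟩
  exact (p.complete φ h.1).resolve_right fun hn => ha _ hn h.2

theorem CompleteType.elemEquiv_of_mem_locus {x : Ctx S} {p : CompleteType L A x}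
    {a a' : Tup M x.2} (ha : a ∈ p.locus) (ha' : a' ∈ p.locus) : ElemEquiv L A a a' :=
  (tp_eq_formulas ha).trans (tp_eq_formulas ha').symm

namespace TypeWithRel

variable {P Q R : TypeWithRel L A}

/-- The pair with the reversed relation. -/
def op (P : TypeWithRel L A) : TypeWithRel L A where
  ctx := P.ctx
  typ := P.typ
  lt a b := P.lt b a

/-- Reversal exchanges left and right by unfolding alone (`P.op.RightGeneric` is `P.LeftGeneric`),
so results on right genericity need no second proof for the left. -/
theorem IsSoPair.op (hP : P.IsSoPair) : P.op.IsSoPair := by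
  obtain ⟨⟨φ, hφ, H⟩, ⟨h₁, h₂, h₃⟩, h₄⟩ := hP
  refine ⟨?_, ⟨h₁, fun x y z hxy hyz => h₂ z y x hyz hxy, fun x y => ?_⟩,
    fun φ => ⟨(h₄ φ).2, (h₄ φ).1⟩⟩
  · let g : (j : Fin P.ctx.1 ⊕ Fin P.ctx.1) →
        L.Term (Sum.elim P.ctx.2 P.ctx.2) (Sum.elim P.ctx.2 P.ctx.2 j) := fun j => match j with
      | Sum.inl i => .var (σ := Sum.elim P.ctx.2 P.ctx.2) (Sum.inr i)
      | Sum.inr i => .var (σ := Sum.elim P.ctx.2 P.ctx.2) (Sum.inl i)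
    obtain ⟨ψ, hψ, K⟩ := (PFormula.Over.defOver hφ).preimage g
    refine ⟨ψ, hψ, fun a b => (H b a).trans (Iff.trans (iff_of_eq (congrArg _ ?_)) (K _).symm)⟩
    funext j
    rcases j with i | i <;> rfl
  · rcases h₃ x y with h | h | h
    · exact Or.inr (Or.inr h)
    · exact Or.inr (Or.inl h)
    · exact Or.inl h

/-- The trace of `D` on the locus is right-eventual. -/
def RightEv (P : TypeWithRel L A) (D : Set (Tup M P.ctx.2)) : Prop :=
  RightEventual P.lt {x | x.1 ∈ D}

theorem rightEv_iff (hP : IsLinear P.lt) {D : Set (Tup M P.ctx.2)} :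
    P.RightEv D ↔ ∃ d, ∀ x, ¬ P.lt x d → x.1 ∈ D := by
  constructor
  · rintro ⟨I, hI, ⟨d, hd⟩, h⟩
    refine ⟨d, fun x hx => hI ?_⟩
    rcases hP.2.2 x d with h' | rfl | h'
    · exact (hx h').elim
    · exact hd
    · exact h d hd x h'
  · rintro ⟨d, hd⟩
    exact ⟨{x | ¬ P.lt x d}, hd, ⟨d, hP.1 d⟩, fun x hx y hy h => hx (hP.2.1 _ _ _ hy h)⟩

theorem RightEv.mono {D E : Set (Tup M P.ctx.2)} (h : P.RightEv D) (hDE : D ⊆ E) :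
    P.RightEv E := by
  obtain ⟨I, hI, h'⟩ := h
  exact ⟨I, fun x hx => hDE (hI hx), h'⟩

theorem RightEv.exists_mem {D : Set (Tup M P.ctx.2)} (h : P.RightEv D) :
    ∃ x ∈ P.typ.locus, x ∈ D := by
  obtain ⟨I, hI, ⟨x, hx⟩, -⟩ := h
  exact ⟨x.1, x.2, hI hx⟩

theorem RightEv.inter (hP : IsLinear P.lt) {D E : Set (Tup M P.ctx.2)} (hD : P.RightEv D)
    (hE : P.RightEv E) : P.RightEv (D ∩ E) := by
  rw [rightEv_iff hP] at *
  obtain ⟨d, hd⟩ := hD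
  obtain ⟨e, he⟩ := hE
  rcases hP.2.2 d e with h | rfl | h
  · exact ⟨e, fun x hx => ⟨hd x fun h' => hx (hP.2.1 _ _ _ h' h), he x hx⟩⟩
  · exact ⟨d, fun x hx => ⟨hd x hx, he x hx⟩⟩
  · exact ⟨d, fun x hx => ⟨hd x hx, he x fun h' => hx (hP.2.1 _ _ _ h' h)⟩⟩

theorem IsSoPair.rightEv_or_compl (hP : P.IsSoPair) {D : Set (Tup M P.ctx.2)}
    (hD : DefOver L C D) : P.RightEv D ∨ P.RightEv Dᶜ := by
  obtain ⟨φ, -, H⟩ := hD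
  have h₁ : P.solutions φ = {x | x.1 ∈ D} := Set.ext fun x => H x.1
  have h₂ : (P.solutions φ)ᶜ = {x | x.1 ∈ Dᶜ} := by rw [h₁]; rfl
  rcases (hP.2.2 φ).2 with h | h
  · exact Or.inl (by rw [RightEv, ← h₁]; exact h.1)
  · exact Or.inr (by rw [RightEv, ← h₂]; exact h.1)

theorem IsSoPair.rightEv_univ (hP : P.IsSoPair) : P.RightEv Set.univ := by
  rcases hP.rightEv_or_compl (DefOver.univ (L := L) (C := A)) with h | h
  · exact h
  · exact h.mono (Set.subset_univ _)

theorem rightGeneric_iff {a : Tup M P.ctx.2} :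
    P.RightGeneric B a ↔ ∀ D, DefOver L (A ∪ B) D → P.RightEv D → a ∈ D := by
  constructor
  · rintro h D ⟨φ, hφ, H⟩ hD
    refine (H a).1 (h φ ⟨?_, hφ⟩)
    have h₁ : P.solutions φ = {x | x.1 ∈ D} := Set.ext fun x => H x.1
    exact (show RightEventual P.lt _ by rw [h₁]; exact hD)
  · rintro h φ ⟨h₁, h₂⟩
    exact h _ (PFormula.Over.defOver h₂) h₁

theorem RightGeneric.mono {B' : Set (Σ s, M s)} {a : Tup M P.ctx.2} (h : P.RightGeneric B' a)
    (hB : B ⊆ B') : P.RightGeneric B a :=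
  fun φ hφ => h φ ⟨hφ.1, hφ.2.trans (Set.union_subset_union_right A hB)⟩

theorem IsSoPair.mem_locus (hP : P.IsSoPair) {a : Tup M P.ctx.2} (h : P.RightGeneric B a) :
    a ∈ P.typ.locus := fun φ hφ =>
  rightGeneric_iff.1 h {x | φ.Realize x}
    (PFormula.Over.defOver ((P.typ.overA φ hφ).trans Set.subset_union_left))
    (by
      obtain ⟨I, -, h⟩ := hP.rightEv_univ
      exact ⟨I, fun x _ => x.2 φ hφ, h⟩)

theorem IsSoPair.exists_rightGeneric (hM : Saturated L M) (hP : P.IsSoPair)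
    (hB : Small (A ∪ B)) : ∃ a, P.RightGeneric B a := by
  obtain ⟨a, ha⟩ := hM.exists_mem_of_directed hB {D | DefOver L (A ∪ B) D ∧ P.RightEv D}
    ⟨_, DefOver.univ, hP.rightEv_univ⟩ (fun D hD => hD.1)
    (fun D hD E hE => ⟨_, ⟨hD.1.inter hE.1, hD.2.inter hP.2.1 hE.2⟩, subset_rfl⟩)
    (fun D hD => by
      obtain ⟨x, -, hx⟩ := hD.2.exists_mem
      exact ⟨x, hx⟩)
  exact ⟨a, rightGeneric_iff.2 fun D h h' => ha D ⟨h, h'⟩⟩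

theorem IsSoPair.rightEv_of_mem (hP : P.IsSoPair) {a : Tup M P.ctx.2}
    (ha : P.RightGeneric B a) {D : Set (Tup M P.ctx.2)} (hD : DefOver L (A ∪ B) D)
    (h : a ∈ D) : P.RightEv D :=
  (hP.rightEv_or_compl hD).resolve_right fun hn => rightGeneric_iff.1 ha _ hD.compl hn h

theorem IsSoPair.elemEquiv_of_rightGeneric (hP : P.IsSoPair) {a a' : Tup M P.ctx.2}
    (ha : P.RightGeneric B a) (ha' : P.RightGeneric B a') : ElemEquiv L (A ∪ B) a a' :=
  elemEquiv_iff.2 fun D hD => ⟨fun h => rightGeneric_iff.1 ha' D hD (hP.rightEv_of_mem ha hD h),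
    fun h => rightGeneric_iff.1 ha D hD (hP.rightEv_of_mem ha' hD h)⟩

theorem RightGeneric.of_elemEquiv {a a' : Tup M P.ctx.2} (ha : P.RightGeneric B a)
    (h : ElemEquiv L (A ∪ B) a a') : P.RightGeneric B a' :=
  rightGeneric_iff.2 fun D hD hr => (h.mem_iff hD).1 (rightGeneric_iff.1 ha D hD hr)

theorem RelDefinable.lt_congr (hP : P.RelDefinable) {x y x' y' : P.typ.locus}
    (h : ElemEquiv L A (x.1.append y.1) (x'.1.append y'.1)) : P.lt x y ↔ P.lt x' y' := by
  obtain ⟨φ, hφ, H⟩ := hP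
  rw [H, H]
  exact h.mem_iff (PFormula.Over.defOver hφ)

/-- Whether a definable set contains all elements above `d` depends only on the type of `d`. -/
theorem RelDefinable.forall_not_lt_of_elemEquiv (hM : Saturated L M) [Infinite (Σ s, M s)]
    (hP : P.RelDefinable) (hC : Small C) (hAC : A ⊆ C) {D : Set (Tup M P.ctx.2)}
    (hD : DefOver L C D) {d d' : P.typ.locus} (h : ElemEquiv L C d.1 d'.1)
    (hd : ∀ x, ¬ P.lt x d → x.1 ∈ D) (x' : P.typ.locus) (hx' : ¬ P.lt x' d') : x'.1 ∈ D := by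
  obtain ⟨x, hx⟩ := h.symm.exists_append hM hC x'.1
  have hxl : x ∈ P.typ.locus := CompleteType.mem_locus_of_elemEquiv x'.2 (hx.snd.mono hAC)
  have := (hP.lt_congr (x := x') (y := d') (x' := ⟨x, hxl⟩) (y' := d)
    (hx.swap.mono hAC)).not.1 hx'
  exact (hx.snd.mem_iff hD).2 (hd ⟨x, hxl⟩ this)

/-- This is the `A`-invariance of the right globalization: a point `d` beyond which the fiber over
`b` holds is moved along with `b` by homogeneity. -/
theorem IsSoPair.rightEv_fiber_congr (hM : Saturated L M) [Infinite (Σ s, M s)] (hA : Small A)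
    (hP : P.IsSoPair) [Finite β] {b b' : Tup M τ} (h : ElemEquiv L A b b')
    {D : Set (Tup M (Sum.elim P.ctx.2 τ))} (hD : DefOver L A D)
    (hr : P.RightEv {x | x.append b ∈ D}) : P.RightEv {x | x.append b' ∈ D} := by
  rw [rightEv_iff hP.2.1] at *
  obtain ⟨d, hd⟩ := hr
  obtain ⟨d', hd'⟩ := h.exists_append hM hA d.1
  refine ⟨⟨d', CompleteType.mem_locus_of_elemEquiv d.2 hd'.snd⟩, fun x' hx' => ?_⟩
  obtain ⟨x, hx⟩ := hd'.symm.exists_append hM hA x'.1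
  have hxl : x ∈ P.typ.locus := CompleteType.mem_locus_of_elemEquiv x'.2 hx.snd
  have h₁ : ElemEquiv L A (x'.1.append d') (x.append d.1) := by
    have := hx.eval (τ := Sum.elim P.ctx.2 P.ctx.2) fun i => match i with
      | Sum.inl i => .var (σ := Sum.elim (Sum.elim τ P.ctx.2) P.ctx.2) (Sum.inr i)
      | Sum.inr i => .var (σ := Sum.elim (Sum.elim τ P.ctx.2) P.ctx.2) (Sum.inl (Sum.inr i))
    convert this using 1 <;> (funext i; rcases i with i | i <;> rfl)
  have h₂ : ElemEquiv L A (x'.1.append b') (x.append b) := by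
    have := hx.eval (τ := Sum.elim P.ctx.2 τ) fun i => match i with
      | Sum.inl i => .var (σ := Sum.elim (Sum.elim τ P.ctx.2) P.ctx.2) (Sum.inr i)
      | Sum.inr i => .var (σ := Sum.elim (Sum.elim τ P.ctx.2) P.ctx.2) (Sum.inl (Sum.inl i))
    convert this using 1 <;> (funext i; rcases i with i | i <;> rfl)
  refine (h₂.mem_iff hD).2 (hd ⟨x, hxl⟩ ?_)
  exact (hP.1.lt_congr (x := x') (y := ⟨d', _⟩) (x' := ⟨x, hxl⟩) (y' := d) h₁).not.1 hx'

theorem IsSoPair.rightGeneric_congr (hM : Saturated L M) [Infinite (Σ s, M s)] (hA : Small A)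
    (hP : P.IsSoPair) [Finite β] {a a' : Tup M P.ctx.2} {b b' : Tup M τ}
    (h : ElemEquiv L A (a.append b) (a'.append b')) (ha : P.RightGeneric b.elems a) :
    P.RightGeneric b'.elems a' := by
  refine rightGeneric_iff.2 fun D hD hr => ?_
  obtain ⟨D', hD', H⟩ := hD.exists_fiber
  have hr' : P.RightEv {x | x.append b' ∈ D'} := hr.mono fun x hx => (H x).2 hx
  have := rightGeneric_iff.1 ha _ (hD'.fiber b) (hP.rightEv_fiber_congr hM hA h.snd.symm hD' hr')
  exact (H a').1 ((h.mem_iff hD').1 this)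

/-- The complement of the elements below `d` is definable and right-eventual. Equality with `d` is
not excluded at this stage; that takes nonorthogonality. -/
theorem IsSoPair.not_lt_of_rightGeneric (hP : P.IsSoPair) {a d : P.typ.locus}
    (ha : P.RightGeneric B a.1) (hd : d.1.elems ⊆ B) : ¬ P.lt a d := by
  obtain ⟨φ, hφ, H⟩ := hP.1
  have hD := ((PFormula.Over.defOver hφ).compl.fiber d.1).mono (Set.union_subset_union_right A hd)
  have := rightGeneric_iff.1 ha _ hD
    ((rightEv_iff hP.2.1).2 ⟨d, fun x hx hφ => hx ((H x d).2 hφ)⟩)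
  exact fun h => this ((H a d).1 h)

/-- Right generic elements form a final part of the locus. -/
theorem IsSoPair.rightGeneric_of_lt (hM : Saturated L M) [Infinite (Σ s, M s)]
    (hP : P.IsSoPair) (hB : Small (A ∪ B)) {c c' : P.typ.locus} (hc : P.RightGeneric B c.1)
    (h : P.lt c c') : P.RightGeneric B c'.1 := by
  refine rightGeneric_iff.2 fun D hD hr => ?_
  obtain ⟨d, hd⟩ := (rightEv_iff hP.2.1).1 hr
  -- The given `c` may lie below `d`. A copy `c₀` generic over `d` as well does not, and carrying
  -- `d` back along `c₀ ≡ c` yields another bound `d'` for `D` that `c` is not below.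
  obtain ⟨c₀, hc₀⟩ := hP.exists_rightGeneric hM (B := B ∪ d.1.elems)
    (by rw [← Set.union_assoc]; exact hB.union_finite d.1.finite_elems)
  have hl := hP.mem_locus hc₀
  have hlt := hP.not_lt_of_rightGeneric (a := ⟨c₀, hl⟩) hc₀ Set.subset_union_right
  obtain ⟨d', hd'⟩ := (hP.elemEquiv_of_rightGeneric (hc₀.mono Set.subset_union_left)
    hc).exists_append hM hB d.1
  have hl' : d' ∈ P.typ.locus :=
    CompleteType.mem_locus_of_elemEquiv d.2 (hd'.snd.mono Set.subset_union_left)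
  refine hP.1.forall_not_lt_of_elemEquiv hM hB Set.subset_union_left hD (d' := ⟨d', hl'⟩)
    hd'.snd hd c' fun hn => ?_
  exact hlt ((hP.1.lt_congr (x := ⟨c₀, hl⟩) (y := d) (x' := c) (y' := ⟨d', hl'⟩)
    (hd'.mono Set.subset_union_left)).2 (hP.2.1.2.1 _ _ _ h hn))

theorem IsSoPair.leftGeneric_of_lt (hM : Saturated L M) [Infinite (Σ s, M s)]
    (hP : P.IsSoPair) (hB : Small (A ∪ B)) {c c' : P.typ.locus} (hc : P.LeftGeneric B c.1)
    (h : P.lt c' c) : P.LeftGeneric B c'.1 :=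
  hP.op.rightGeneric_of_lt hM hB (P := P.op) (c := c) hc h

/-- If an element is both left and right generic over `b`, then the types are weakly
orthogonal. -/
theorem IsSoPair.weaklyOrthogonal (hM : Saturated L M) [Infinite (Σ s, M s)] (hA : Small A)
    (hP : P.IsSoPair) {x : Ctx S} {q : CompleteType L A x} {b : Tup M x.2} (hb : b ∈ q.locus)
    {a : Tup M P.ctx.2} (hr : P.RightGeneric b.elems a) (hl : P.LeftGeneric b.elems a) :
    WeaklyOrthogonal P.typ q := by
  have ha := hP.mem_locus hr
  have hB : Small (A ∪ b.elems) := hA.union_finite b.finite_elems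
  -- Everything above `a` is right generic and everything below it is left generic, so all
  -- realizations share the type of `a` over `A` and `b`.
  have key : ∀ a' ∈ P.typ.locus, ElemEquiv L A (a.append b) (a'.append b) := by
    intro a' ha'
    refine elemEquiv_union_elems_iff.1 ?_
    rcases hP.2.1.2.2 ⟨a, ha⟩ ⟨a', ha'⟩ with h | h | h
    · exact hP.elemEquiv_of_rightGeneric hr
        (hP.rightGeneric_of_lt hM hB (c := ⟨a, ha⟩) (c' := ⟨a', ha'⟩) hr h)
    · cases h
      exact .refl _ _
    · exact hP.op.elemEquiv_of_rightGeneric hl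
        (hP.leftGeneric_of_lt hM hB (c := ⟨a, ha⟩) (c' := ⟨a', ha'⟩) hl h)
  have key' : ∀ a' ∈ P.typ.locus, ∀ b' ∈ q.locus,
      ElemEquiv L A (a.append b) (a'.append b') := by
    intro a' ha' b' hb'
    obtain ⟨c, hc⟩ := (CompleteType.elemEquiv_of_mem_locus hb' hb).exists_append hM hA a'
    exact (key c (CompleteType.mem_locus_of_elemEquiv ha' hc.snd)).trans hc.swap.symm
  exact fun a₁ h₁ a₂ h₂ b₁ k₁ b₂ k₂ => (key' a₁ h₁ b₁ k₁).symm.trans (key' a₂ h₂ b₂ k₂)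

end TypeWithRel

end SoPairs

/-! ### Transitivity and interpolation for directly nonorthogonal pairs. -/

section Direct

variable {S : Type u} {L : SortedLanguage.{u, v, w} S} {M : S → Type m} [L.Str M]
variable {α β : Type} {σ : α → S} {τ : β → S} {A B C : Set (Σ s, M s)}

theorem WeaklyOrthogonal.symm {x y : Ctx S} {p : CompleteType L A x} {q : CompleteType L A y}
    (h : WeaklyOrthogonal p q) : WeaklyOrthogonal q p :=
  fun b hb b' hb' a ha a' ha' => (h a ha a' ha' b hb b' hb').swap

open TypeWithRel

variable {P Q R : TypeWithRel L A}

theorem DirectlyNonorthogonal.symm (h : DirectlyNonorthogonal P Q) :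
    DirectlyNonorthogonal Q P :=
  ⟨fun hw => h.1 hw.symm, fun b hb a ha => ⟨(h.2 a ha b hb).2.symm, (h.2 a ha b hb).1.symm⟩⟩

theorem DirectlyNonorthogonal.op (h : DirectlyNonorthogonal P Q) :
    DirectlyNonorthogonal P.op Q.op :=
  ⟨h.1, fun a ha b hb => ⟨(h.2 a ha b hb).2, (h.2 a ha b hb).1⟩⟩

namespace TypeWithRel

/-- Right genericity is transitive along directly nonorthogonal pairs. -/
theorem IsSoPair.rightGeneric_trans (hM : Saturated L M) [Infinite (Σ s, M s)]
    (hA : Small A) (hQ : Q.IsSoPair) (hR : R.IsSoPair)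
    (hQR : DirectlyNonorthogonal Q R) [Finite α] {a : Tup M σ} {b : Tup M Q.ctx.2}
    {c : Tup M R.ctx.2} (hab : Q.RightGeneric a.elems b) (hbc : R.RightGeneric b.elems c) :
    R.RightGeneric a.elems c := by
  have hb := hQ.mem_locus hab
  have hc := hR.mem_locus hbc
  refine rightGeneric_iff.2 fun D hD hr => ?_
  by_contra hcD
  obtain ⟨e, he⟩ := (rightEv_iff hR.2.1).1 hr
  have hAa : Small (A ∪ a.elems) := hA.union_finite a.finite_elems
  -- The copy `b'` of `b` is chosen generic over the bound `e` of `D` too. The matching copy `c'` of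
  -- `c` stays outside `D`, hence below `e`, so `e` is right generic over `b'`. Then `b'` is left as
  -- well as right generic over `e`, a contradiction.
  obtain ⟨b', hb'⟩ := hQ.exists_rightGeneric hM (B := a.elems ∪ e.1.elems)
    (hA.union_finite (a.finite_elems.union e.1.finite_elems))
  have hb'l := hQ.mem_locus hb'
  obtain ⟨c', hc'⟩ := (hQ.elemEquiv_of_rightGeneric hab
    (hb'.mono Set.subset_union_left)).exists_append hM hAa c
  have hbc' : R.RightGeneric b'.elems c' :=
    hR.rightGeneric_congr hM hA (hc'.swap.mono Set.subset_union_left) hbc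
  have hc'l := hR.mem_locus hbc'
  have hc'D : c' ∉ D := fun h => hcD ((hc'.snd.mem_iff hD).2 h)
  have hlt : R.lt ⟨c', hc'l⟩ e := by
    by_contra hn
    exact hc'D (he _ hn)
  have hbe : R.RightGeneric b'.elems e.1 :=
    hR.rightGeneric_of_lt hM (hA.union_finite b'.finite_elems) (c := ⟨c', hc'l⟩) hbc' hlt
  exact hQR.1 (hQ.weaklyOrthogonal hM hA e.2 (hb'.mono Set.subset_union_right)
    ((hQR.2 b' hb'l e.1 e.2).1.2 hbe))

theorem IsSoPair.leftGeneric_trans (hM : Saturated L M) [Infinite (Σ s, M s)]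
    (hA : Small A) (hQ : Q.IsSoPair) (hR : R.IsSoPair)
    (hQR : DirectlyNonorthogonal Q R) [Finite α] {a : Tup M σ} {b : Tup M Q.ctx.2}
    {c : Tup M R.ctx.2} (hab : Q.LeftGeneric a.elems b) (hbc : R.LeftGeneric b.elems c) :
    R.LeftGeneric a.elems c :=
  IsSoPair.rightGeneric_trans hM hA (Q := Q.op) (R := R.op) hQ.op hR.op hQR.op hab hbc

/-- A chain is built upwards from `a`, and its top is then moved to `c`, possible because right
generics over `a` have a single type over `Aa`. -/
theorem IsSoPair.exists_rightGeneric_between (hM : Saturated L M) [Infinite (Σ s, M s)]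
    (hA : Small A) (hQ : Q.IsSoPair) (hR : R.IsSoPair)
    [Finite α] {a : Tup M σ} {c : Tup M R.ctx.2} (hac : R.RightGeneric a.elems c) :
    ∃ b, Q.RightGeneric a.elems b ∧ R.RightGeneric b.elems c := by
  have hAa : Small (A ∪ a.elems) := hA.union_finite a.finite_elems
  obtain ⟨b, hb⟩ := hQ.exists_rightGeneric hM hAa
  obtain ⟨c', hc'⟩ := hR.exists_rightGeneric hM (B := a.elems ∪ b.elems)
    (hA.union_finite (a.finite_elems.union b.finite_elems))
  obtain ⟨b', hb'⟩ := (hR.elemEquiv_of_rightGeneric (hc'.mono Set.subset_union_left)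
    hac).exists_append hM hAa b
  exact ⟨b', hb.of_elemEquiv hb'.snd, hR.rightGeneric_congr hM hA
    (hb'.mono Set.subset_union_left) (hc'.mono Set.subset_union_right)⟩

theorem IsSoPair.exists_leftGeneric_between (hM : Saturated L M) [Infinite (Σ s, M s)]
    (hA : Small A) (hQ : Q.IsSoPair) (hR : R.IsSoPair)
    [Finite α] {a : Tup M σ} {c : Tup M R.ctx.2} (hac : R.LeftGeneric a.elems c) :
    ∃ b, Q.LeftGeneric a.elems b ∧ R.LeftGeneric b.elems c :=
  IsSoPair.exists_rightGeneric_between hM hA (Q := Q.op) (R := R.op) hQ.op hR.op hac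

/-- An element of `Q` is interpolated, each of the two steps is reversed, and transitivity
recombines them. -/
theorem leftGeneric_iff_rightGeneric_of_direct (hM : Saturated L M) [Infinite (Σ s, M s)]
    (hA : Small A) (hP : P.IsSoPair) (hQ : Q.IsSoPair)
    (hR : R.IsSoPair) (hPQ : DirectlyNonorthogonal P Q) (hQR : DirectlyNonorthogonal Q R)
    {a : Tup M P.ctx.2} (ha : a ∈ P.typ.locus) {c : Tup M R.ctx.2} (hc : c ∈ R.typ.locus) :
    P.LeftGeneric c.elems a ↔ R.RightGeneric a.elems c := by
  constructor
  · intro h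
    obtain ⟨b, hcb, hba⟩ := IsSoPair.exists_leftGeneric_between hM hA hQ hP h
    have hb := hQ.op.mem_locus hcb
    exact hQ.rightGeneric_trans hM hA hR hQR ((hPQ.2 a ha b hb).1.1 hba)
      ((hQR.2 b hb c hc).1.1 hcb)
  · intro h
    obtain ⟨b, hab, hbc⟩ := IsSoPair.exists_rightGeneric_between hM hA hQ hR h
    have hb := hQ.mem_locus hab
    exact hQ.leftGeneric_trans hM hA hP hPQ.symm ((hQR.2 b hb c hc).1.2 hbc)
      ((hPQ.2 a ha b hb).1.2 hab)

end TypeWithRel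

theorem DirectlyNonorthogonal.trans (hM : Saturated L M) [Infinite (Σ s, M s)] (hA : Small A)
    (hP : P.IsSoPair) (hQ : Q.IsSoPair) (hR : R.IsSoPair)
    (hPQ : DirectlyNonorthogonal P Q) (hQR : DirectlyNonorthogonal Q R) :
    DirectlyNonorthogonal P R := by
  refine ⟨fun hw => ?_, fun a ha c hc => ⟨?_, ?_⟩⟩
  -- Take `b` left generic over `c` and `a` left generic over `b`. Weak orthogonality of `P` and `R`
  -- would make `a` right generic over `c`; since `b` is right generic over `a`, it would be right
  -- generic over `c` too, so both left and right.
  · have hA' : ∀ {y : Ctx S} (a : Tup M y.2), Small (A ∪ a.elems) :=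
      fun a => hA.union_finite a.finite_elems
    obtain ⟨c, hc⟩ := hR.exists_rightGeneric hM (B := ∅) (by rwa [Set.union_empty])
    have hcl := hR.mem_locus hc
    obtain ⟨b, hb⟩ := hQ.op.exists_rightGeneric hM (hA' c)
    have hbl := hQ.op.mem_locus hb
    obtain ⟨a, ha⟩ := hP.op.exists_rightGeneric hM (hA' b)
    have hal := hP.op.mem_locus ha
    obtain ⟨a', ha'⟩ := hP.exists_rightGeneric hM (hA' c)
    have hca : P.RightGeneric c.elems a := hP.rightGeneric_congr hM hA
      (hw a' (hP.mem_locus ha') a hal c hcl c hcl) ha'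
    have hcb := hP.rightGeneric_trans hM hA hQ hPQ hca ((hPQ.2 a hal b hbl).1.1 ha)
    exact hQR.1 (hQ.weaklyOrthogonal hM hA hcl hcb hb)
  · exact leftGeneric_iff_rightGeneric_of_direct hM hA hP hQ hR hPQ hQR ha hc
  · exact (leftGeneric_iff_rightGeneric_of_direct hM hA hR hQ hP hQR.symm hPQ.symm hc ha).symm

namespace TypeWithRel

theorem IsSoPair.not_leftGeneric_and_rightGeneric (hM : Saturated L M) [Infinite (Σ s, M s)]
    (hA : Small A) (hP : P.IsSoPair) (h : DirectlyNonorthogonal P Q) {a : Tup M P.ctx.2}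
    {b : Tup M Q.ctx.2} (hb : b ∈ Q.typ.locus) :
    ¬ (P.LeftGeneric b.elems a ∧ P.RightGeneric b.elems a) :=
  fun H => h.1 (hP.weaklyOrthogonal hM hA hb H.2 H.1)

/-- An element that is right generic over another element of the locus is above it. -/
theorem IsSoPair.lt_of_rightGeneric (hM : Saturated L M) [Infinite (Σ s, M s)]
    (hA : Small A) (hP : P.IsSoPair) (h : DirectlyNonorthogonal P P) {a b : P.typ.locus}
    (hab : P.RightGeneric a.1.elems b.1) : P.lt a b := by
  rcases hP.2.1.2.2 a b with h' | rfl | h'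
  · exact h'
  -- An element right generic over itself is also left generic over itself, by direct
  -- nonorthogonality of `P` with itself.
  · exact (hP.not_leftGeneric_and_rightGeneric hM hA h a.2
      ⟨(h.2 a.1 a.2 a.1 a.2).1.2 hab, hab⟩).elim
  · exact (hP.not_lt_of_rightGeneric hab subset_rfl h').elim

end TypeWithRel

end Direct

/-! ### Forking independence is genericity on one of the two sides. -/

section Forking

variable {S : Type u} {L : SortedLanguage.{u, v, w} S} {M : S → Type m} [L.Str M]
variable {α β : Type} {σ : α → S} {τ : β → S} {A B C : Set (Σ s, M s)}

/-- A formula with infinitely many pairwise inconsistent conjugates divides. -/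
theorem DefOver.exists_divides [Finite β] {D : Set (Tup M (Sum.elim σ τ))}
    (hD : DefOver L A D) (b : Tup M τ) (bs : ℕ → Tup M τ) (h : ∀ i, ElemEquiv L A (bs i) b)
    (hdisj : ∀ i j, i < j → ∀ a : Tup M σ, a.append (bs i) ∈ D → a.append (bs j) ∉ D) :
    ∃ ψ : PFormula L M σ, ψ.Divides A ∧ ∀ a, ψ.Realize a ↔ a.append b ∈ D := by
  obtain ⟨⟨x, φ, c⟩, hφ, H⟩ := hD
  obtain ⟨n, e, g, hg⟩ := exists_listing (L := L) (M := M) (Sum.elim τ x.2)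
  let ρ : α ⊕ Fin n → S := Sum.elim σ fun i => Sum.elim τ x.2 (e i)
  let g' : (j : (α ⊕ β) ⊕ Fin x.1) → L.Term ρ (Sum.elim (Sum.elim σ τ) x.2 j) := fun j =>
    match j with
    | Sum.inl (Sum.inl i) => .var (σ := ρ) (Sum.inl i)
    | Sum.inl (Sum.inr k) => (g (Sum.inl k)).subst fun i => .var (σ := ρ) (Sum.inr i)
    | Sum.inr k => (g (Sum.inr k)).subst fun i => .var (σ := ρ) (Sum.inr i)
  have key : ∀ (a : Tup M σ) (b : Tup M τ),
      (φ.subst g').Realize (a.append fun i => (b.append c) (e i)) ↔ a.append b ∈ D := by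
    intro a b
    refine (Formula.realize_subst _ _ _).trans
      (Iff.trans (iff_of_eq (congrArg φ.Realize ?_)) (H _))
    funext j
    rcases j with (i | k) | k
    · rfl
    · exact (Term.eval_subst _ _ _).trans (hg (b.append c) (Sum.inl k))
    · exact (Term.eval_subst _ _ _).trans (hg (b.append c) (Sum.inr k))
  -- The parameters `c` of `D` come from `A`, so they join the parameter tuple and stay fixed in all
  -- conjugates. Disjointness gives inconsistency with `k = 2`.
  refine ⟨⟨⟨n, fun i => Sum.elim τ x.2 (e i)⟩, φ.subst g', fun i => (b.append c) (e i)⟩,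
    ⟨2, two_pos, fun k i => ((bs k).append c) (e i), fun k => ?_, fun s hs => ?_⟩,
    fun a => key a b⟩
  · have hc : A ∪ c.elems = A := Set.union_eq_left.2 hφ
    have := elemEquiv_union_elems_iff.1 (by rw [hc]; exact h k :
      ElemEquiv L (A ∪ c.elems) (bs k) b)
    exact this.eval fun i => .var (σ := Sum.elim τ x.2) (e i)
  · rintro ⟨a, ha⟩
    have hex : ∃ i ∈ s, ∃ j ∈ s, i < j := by
      obtain ⟨i, j, hij, rfl⟩ := Finset.card_eq_two.1 hs
      rcases hij.lt_or_gt with h' | h'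
      · exact ⟨i, by simp, j, by simp, h'⟩
      · exact ⟨j, by simp, i, by simp, h'⟩
    obtain ⟨i, hi, j, hj, hij⟩ := hex
    exact hdisj i j hij a ((key a (bs i)).1 (ha i hi)) ((key a (bs j)).1 (ha j hj))

namespace TypeWithRel

variable {P Q : TypeWithRel L A}

theorem IsSoPair.rightEv_forall_mem (hP : P.IsSoPair) {ι : Type*} (s : Finset ι)
    (D : ι → Set (Tup M P.ctx.2)) (h : ∀ i ∈ s, P.RightEv (D i)) :
    P.RightEv {x | ∀ i ∈ s, x ∈ D i} := by
  classical
  induction s using Finset.induction_on with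
  | empty => exact hP.rightEv_univ.mono fun x _ => by simp
  | insert i s _ ih =>
    refine ((h i (Finset.mem_insert_self i s)).inter hP.2.1
      (ih fun j hj => h j (Finset.mem_insert_of_mem hj))).mono ?_
    rintro x ⟨h₁, h₂⟩ j hj
    rcases Finset.mem_insert.1 hj with rfl | hj
    · exact h₁
    · exact h₂ j hj

/-- By invariance all conjugates of a right-eventual formula are right-eventual, so any `k` of them
have a common solution. -/
theorem IsSoPair.not_rightEv_of_divides (hM : Saturated L M) [Infinite (Σ s, M s)]
    (hA : Small A) (hP : P.IsSoPair) {ψ : PFormula L M P.ctx.2} (hψ : ψ.Divides A) :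
    ¬ P.RightEv {x | ψ.Realize x} := by
  intro hr
  obtain ⟨k, -, b, hb, hk⟩ := hψ
  have hform : DefOver L A {z : Tup M (Sum.elim P.ctx.2 ψ.ctx.2) | ψ.form.Realize z} := by
    let τ : Fin 0 → S := fun i => i.elim0
    let g : (j : Fin P.ctx.1 ⊕ Fin ψ.ctx.1) → L.Term
        (Sum.elim (Sum.elim P.ctx.2 ψ.ctx.2) τ) (Sum.elim P.ctx.2 ψ.ctx.2 j) :=
      fun j => .var (σ := Sum.elim (Sum.elim P.ctx.2 ψ.ctx.2) τ) (Sum.inl j)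
    refine ⟨⟨⟨0, τ⟩, ψ.form.subst g, fun i => i.elim0⟩, ?_, fun z => Formula.realize_subst _ _ _⟩
    rintro _ ⟨i, rfl⟩
    exact i.elim0
  obtain ⟨x, -, hx⟩ := (hP.rightEv_forall_mem (Finset.range k)
    (fun i => {x | ψ.form.Realize (x.append (b i))})
    fun i _ => hP.rightEv_fiber_congr hM hA (hb i).symm hform hr).exists_mem
  exact hk (Finset.range k) (Finset.card_range k) ⟨x, hx⟩

/-- Formulas of the type are right-eventual and so are the negations of dividing formulas; finitely
many of them meet, so no forking cover exists. -/
theorem IsSoPair.indep_of_rightGeneric (hM : Saturated L M) [Infinite (Σ s, M s)]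
    (hA : Small A) (hP : P.IsSoPair) {a : Tup M P.ctx.2} (ha : P.RightGeneric B a) :
    Indep L A a B := by
  rintro ⟨t, ht, s, hs, h⟩
  have h₁ : P.RightEv {x | ∀ φ ∈ s, x ∈ {x | φ.Realize x}} :=
    hP.rightEv_forall_mem s (fun φ => {x | φ.Realize x}) fun φ hφ =>
      hP.rightEv_of_mem ha (PFormula.Over.defOver (hs hφ).1) (hs hφ).2
  have h₂ : P.RightEv {x | ∀ ψ ∈ t, x ∈ {x | ψ.Realize x}ᶜ} :=
    hP.rightEv_forall_mem t (fun ψ => {x | ψ.Realize x}ᶜ) fun ψ hψ =>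
      (hP.rightEv_or_compl (PFormula.Over.defOver (C := Set.univ)
        (φ := ψ) (Set.subset_univ _))).resolve_left (hP.not_rightEv_of_divides hM hA (ht ψ hψ))
  obtain ⟨x, -, hx₁, hx₂⟩ := (h₁.inter hP.2.1 h₂).exists_mem
  obtain ⟨ψ, hψ, H⟩ := h x hx₁
  exact hx₂ ψ hψ H

/-- An interval of the locus moves to an infinite sequence of intervals to the right of it. -/
theorem IsSoPair.exists_interval_sequence (hM : Saturated L M) [Infinite (Σ s, M s)]
    (hA : Small A) (hP : P.IsSoPair) (hPP : DirectlyNonorthogonal P P) {d e : P.typ.locus}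
    (hde : P.lt d e) :
    ∃ f : ℕ → P.typ.locus × P.typ.locus, f 0 = (d, e) ∧
      (∀ i, ElemEquiv L A ((f i).1.1.append (f i).2.1) (d.1.append e.1)) ∧
      ∀ i j, i < j → P.RightGeneric (f i).2.1.elems (f j).1.1 := by
  have step : ∀ y : P.typ.locus × P.typ.locus, ∃ z : P.typ.locus × P.typ.locus,
      ElemEquiv L A (z.1.1.append z.2.1) (y.1.1.append y.2.1) ∧
        P.RightGeneric y.2.1.elems z.1.1 := by
    rintro ⟨d, e⟩
    obtain ⟨d', hd'⟩ := hP.exists_rightGeneric hM (hA.union_finite e.1.finite_elems)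
    have hl := hP.mem_locus hd'
    obtain ⟨e', he'⟩ := (CompleteType.elemEquiv_of_mem_locus d.2 hl).exists_append hM hA e.1
    exact ⟨(⟨d', hl⟩, ⟨e', CompleteType.mem_locus_of_elemEquiv e.2 he'.snd⟩), he'.symm, hd'⟩
  choose F hF₁ hF₂ using step
  let f : ℕ → P.typ.locus × P.typ.locus := fun n => F^[n] (d, e)
  have hf : ∀ n, f (n + 1) = F (f n) := fun n => Function.iterate_succ_apply' F n (d, e)
  have h₁ : ∀ i, ElemEquiv L A ((f i).1.1.append (f i).2.1) (d.1.append e.1) := by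
    intro i
    induction i with
    | zero => exact .refl _ _
    | succ n ih =>
      rw [hf]
      exact (hF₁ _).trans ih
  have h₂ : ∀ i, P.RightGeneric (f i).2.1.elems (f (i + 1)).1.1 := by
    intro i
    rw [hf]
    exact hF₂ _
  -- The right endpoint inherits genericity from the left one below it; this lets consecutive steps
  -- be chained by transitivity.
  have h₃ : ∀ i j, P.RightGeneric (f i).2.1.elems (f j).1.1 →
      P.RightGeneric (f i).2.1.elems (f j).2.1 := fun i j h =>
    hP.rightGeneric_of_lt hM (hA.union_finite (f i).2.1.finite_elems) h
      ((hP.1.lt_congr (h₁ j)).2 hde)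
  refine ⟨f, rfl, h₁, fun i j hij => ?_⟩
  induction j, hij using Nat.le_induction with
  | base => exact h₂ i
  | succ j _ ih => exact hP.rightGeneric_trans hM hA hP hPP (h₃ i j ih) (h₂ j)

/-- Failure of genericity on both sides yields `d` and `e` such that the type of `a` over `Ab`
forces `d < x < e` on the locus. This interval, cut down by a formula of the type of `a` over `A`,
divides. -/
theorem IsSoPair.not_indep (hM : Saturated L M) [Infinite (Σ s, M s)]
    (hA : Small A) (hP : P.IsSoPair) (hPP : DirectlyNonorthogonal P P) [Finite β]
    {b : Tup M τ} {a : Tup M P.ctx.2} (ha : a ∈ P.typ.locus)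
    (hr : ¬ P.RightGeneric b.elems a) (hl : ¬ P.LeftGeneric b.elems a) :
    ¬ Indep L A a b.elems := by
  have hl' : ∃ D : Set (Tup M P.ctx.2), DefOver L (A ∪ b.elems) D ∧ P.op.RightEv D ∧ a ∉ D := by
    by_contra! h
    exact hl ((rightGeneric_iff (P := P.op)).2 h)
  rw [rightGeneric_iff] at hr
  push Not at hr
  obtain ⟨D₁, hD₁, hr₁, haD₁⟩ := hr
  obtain ⟨D₂, hD₂, hr₂, haD₂⟩ := hl'
  obtain ⟨e, he⟩ := (rightEv_iff hP.2.1).1 hr₁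
  obtain ⟨d, hd⟩ := (rightEv_iff hP.op.2.1).1 hr₂
  have h_lt : ∀ x : P.typ.locus, x.1 ∉ D₁ → P.lt x e := fun x hx => by
    by_contra hn
    exact hx (he x hn)
  have h_gt : ∀ x : P.typ.locus, x.1 ∉ D₂ → P.lt d x := fun x hx => by
    by_contra hn
    exact hx (hd x hn)
  obtain ⟨f, hf₀, hf₁, hf₂⟩ := hP.exists_interval_sequence hM hA hPP (d := d) (e := e)
    (hP.2.1.2.1 _ _ _ (h_gt ⟨a, ha⟩ haD₂) (h_lt ⟨a, ha⟩ haD₁))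
  obtain ⟨φ, hφ, H⟩ := hP.1
  let σ := P.ctx.2
  let ν := Sum.elim σ (Sum.elim σ σ)
  let g₁ : (j : Fin P.ctx.1 ⊕ Fin P.ctx.1) → L.Term ν (Sum.elim σ σ j) := fun j => match j with
    | Sum.inl i => .var (σ := ν) (Sum.inl i)
    | Sum.inr i => .var (σ := ν) (Sum.inr (Sum.inr i))
  let g₂ : (j : Fin P.ctx.1 ⊕ Fin P.ctx.1) → L.Term ν (Sum.elim σ σ j) := fun j => match j with
    | Sum.inl i => .var (σ := ν) (Sum.inr (Sum.inl i))
    | Sum.inr i => .var (σ := ν) (Sum.inl i)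
  let V : Set (Tup M ν) := {z | φ.Realize fun j => (g₁ j).eval z} ∩
    {z | φ.Realize fun j => (g₂ j).eval z}
  have hV : DefOver L A V :=
    ((PFormula.Over.defOver hφ).preimage g₁).inter ((PFormula.Over.defOver hφ).preimage g₂)
  have hV_mem : ∀ x d e : Tup M σ, x.append (d.append e) ∈ V ↔
      φ.Realize (x.append e) ∧ φ.Realize (d.append x) := by
    intro x d e
    refine and_congr (iff_of_eq (congrArg φ.Realize ?_)) (iff_of_eq (congrArg φ.Realize ?_)) <;>
    · funext j
      rcases j with j | j <;> rfl
  have hV_iff : ∀ x d e : P.typ.locus,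
      x.1.append (d.1.append e.1) ∈ V ↔ P.lt x e ∧ P.lt d x := by
    intro x d e
    rw [H, H]
    exact hV_mem _ _ _
  have hAde : ∀ d e : P.typ.locus, Small (A ∪ (d.1.append e.1).elems) := fun d e =>
    hA.union_finite (Tup.finite_elems _)
  -- The left end of interval `1` is not below `e`, so no realization lies between it and `e`. Off
  -- the locus the formula defining `<` is uncontrolled; compactness supplies `Θ`, which forces
  -- emptiness there too.
  obtain ⟨Θ, hΘ, haΘ, hΘV⟩ := hM.exists_mem_subset (hAde (f 1).1 e) Set.subset_union_left a
    (hV.compl.fiber ((f 1).1.1.append e.1)) (fun a' ha' hn => by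
      have hl := CompleteType.mem_locus_of_elemEquiv ha ha'
      obtain ⟨h₁, h₂⟩ := (hV_iff ⟨a', hl⟩ _ _).1 hn
      have := hf₂ 0 1 one_pos
      rw [hf₀] at this
      exact hP.not_lt_of_rightGeneric this subset_rfl (hP.2.1.2.1 _ _ _ h₂ h₁))
  let W : Set (Tup M ν) := {z | (fun i => (Term.var (σ := ν) (Sum.inl i) : L.Term ν (σ i)).eval z)
    ∈ Θ} ∩ V
  have hW : DefOver L A W := (hΘ.preimage _).inter hV
  -- All pairs of a later left end and an earlier right end have the same type over `A`, so the
  -- single `Θ` separates all intervals.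
  have hconj : ∀ i j, i < j → ElemEquiv L A ((f j).1.1.append (f i).2.1)
      ((f 1).1.1.append e.1) := by
    intro i j hij
    have h₀ : P.RightGeneric e.1.elems (f 1).1.1 := by
      have := hf₂ 0 1 one_pos
      rwa [hf₀] at this
    obtain ⟨y, hy⟩ := (CompleteType.elemEquiv_of_mem_locus (f i).2.2 e.2).exists_append hM hA
      (f j).1.1
    have hy' := hP.rightGeneric_congr hM hA hy.swap (hf₂ i j hij)
    exact hy.swap.trans (elemEquiv_union_elems_iff.1 (hP.elemEquiv_of_rightGeneric hy' h₀))
  have hdisj : ∀ i j, i < j → ∀ x : Tup M σ, x.append ((f i).1.1.append (f i).2.1) ∈ W →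
      x.append ((f j).1.1.append (f j).2.1) ∉ W := by
    intro i j hij x hxi hxj
    obtain ⟨x', hx'⟩ := (hconj i j hij).exists_append hM hA x
    have : x'.append ((f 1).1.1.append e.1) ∈ W :=
      (hx'.swap.mem_iff hW).1
        ⟨hxi.1, (hV_mem _ _ _).2 ⟨((hV_mem _ _ _).1 hxi.2).1, ((hV_mem _ _ _).1 hxj.2).2⟩⟩
    exact hΘV this.1 this.2
  obtain ⟨ψ, hψ, hψW⟩ := hW.exists_divides (d.1.append e.1)
    (fun i => (f i).1.1.append (f i).2.1) hf₁ hdisj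
  -- By compactness one formula `χ` of the type of `a` over `Ab` already implies the dividing
  -- formula.
  obtain ⟨D, ⟨χ, hχ, hχD⟩, haD, hDW⟩ := hM.exists_mem_subset (C := A ∪ b.elems)
    ((hA.union_finite b.finite_elems).union_finite (d.1.append e.1).finite_elems)
    Set.subset_union_left a ((hW.mono Set.subset_union_left).fiber (d.1.append e.1))
    (fun a' ha' => by
      have hl := CompleteType.mem_locus_of_elemEquiv ha (ha'.mono Set.subset_union_left)
      refine ⟨((ha'.mono Set.subset_union_left).mem_iff hΘ).1 haΘ, (hV_iff ⟨a', hl⟩ d e).2 ⟨?_, ?_⟩⟩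
      · exact h_lt _ fun h => haD₁ ((ha'.mem_iff hD₁).2 h)
      · exact h_gt _ fun h => haD₂ ((ha'.mem_iff hD₂).2 h))
  refine fun hind => hind ⟨{ψ}, by simpa using hψ, {χ}, ?_, fun x hx => ?_⟩
  · simpa using (show χ ∈ tp L a (A ∪ b.elems) from ⟨hχ, (hχD a).2 haD⟩)
  · exact ⟨ψ, by simp, (hψW x).2 (hDW ((hχD x).1 (hx χ (by simp))))⟩

theorem IsSoPair.indep_iff (hM : Saturated L M) [Infinite (Σ s, M s)]
    (hA : Small A) (hP : P.IsSoPair) (hPP : DirectlyNonorthogonal P P) [Finite β]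
    {b : Tup M τ} {a : Tup M P.ctx.2} (ha : a ∈ P.typ.locus) :
    Indep L A a b.elems ↔ P.RightGeneric b.elems a ∨ P.LeftGeneric b.elems a := by
  constructor
  · intro h
    by_contra! hn
    exact hP.not_indep hM hA hPP ha hn.1 hn.2 h
  · rintro (h | h)
    · exact hP.indep_of_rightGeneric hM hA h
    · exact hP.op.indep_of_rightGeneric hM hA h

end TypeWithRel

end Forking

/-! ### Strict weak orders, their linear refinements and quotients. -/

section Orders

variable {X : Type*} {g b r E : X → X → Prop}

/-- A strict weak order, refined within the classes of incomparable elements by a linear order. -/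
theorem isLinear_refinement (hg : IsStrictPartial g) (hw : ∀ x y z, g x y → g x z ∨ g z y)
    (hb : IsLinear b) : IsLinear fun x y => g x y ∨ ¬ g y x ∧ b x y := by
  refine ⟨fun x => ?_, fun x y z => ?_, fun x y => ?_⟩
  · rintro (h | h)
    · exact hg.1 x h
    · exact hb.1 x h.2
  · rintro (h | ⟨h, h'⟩) (k | ⟨k, k'⟩)
    · exact Or.inl (hg.2 _ _ _ h k)
    · exact Or.inl ((hw x y z h).resolve_right k)
    · exact Or.inl ((hw y z x k).resolve_left h)
    · exact Or.inr ⟨fun H => (hw z x y H).elim k h, hb.2.1 _ _ _ h' k'⟩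
  · by_cases h : g x y
    · exact Or.inl (Or.inl h)
    by_cases h' : g y x
    · exact Or.inr (Or.inr (Or.inl h'))
    rcases hb.2.2 x y with k | k | k
    · exact Or.inl (Or.inr ⟨h', k⟩)
    · exact Or.inr (Or.inl k)
    · exact Or.inr (Or.inr (Or.inr ⟨h, k⟩))

theorem equivalence_of_iff_incomparable (hg : IsStrictPartial g)
    (hw : ∀ x y z, g x y → g x z ∨ g z y) (hE : ∀ x y, E x y ↔ ¬ g x y ∧ ¬ g y x) :
    Equivalence E where
  refl x := (hE x x).2 ⟨hg.1 x, hg.1 x⟩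
  symm h := (hE _ _).2 ((hE _ _).1 h).symm
  trans {x y z} h k := by
    rw [hE] at *
    exact ⟨fun H => (hw x z y H).elim h.1 k.1, fun H => (hw z x y H).elim k.2 h.2⟩

theorem hasConvexClasses_of_iff_incomparable (hr : IsLinear r)
    (hw : ∀ x y z, g x y → g x z ∨ g z y) (hgr : ∀ x y, g x y → r x y)
    (hE : ∀ x y, E x y ↔ ¬ g x y ∧ ¬ g y x) : HasConvexClasses r E := by
  intro x a b c hxa hxb hac hcb
  have asymm : ∀ x y, r x y → ¬ g y x := fun x y h h' => hr.1 x (hr.2.1 _ _ _ h (hgr _ _ h'))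
  rw [hE] at *
  refine ⟨fun H => ?_, fun H => ?_⟩
  · exact (hw x c b H).elim hxb.1 (asymm _ _ hcb)
  · exact (hw c x a H).elim (asymm _ _ hac) hxa.2

/-- The quotient order depends on `g` only: if `x` and `y` were `g`-incomparable, `x` would
represent both classes and `r x x` would follow. -/
theorem quotientLT_mk_iff (hr : IsLinear r) (hw : ∀ x y z, g x y → g x z ∨ g z y)
    (hgr : ∀ x y, g x y → r x y) (hE : ∀ x y, E x y ↔ ¬ g x y ∧ ¬ g y x) (h : Equivalence E)
    (x y : X) :
    quotientLT r ⟨E, h⟩ (Quotient.mk ⟨E, h⟩ x) (Quotient.mk ⟨E, h⟩ y) ↔ g x y := by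
  constructor
  · intro H
    by_contra hn
    by_cases hn' : g y x
    · exact hr.1 x (hr.2.1 _ _ _ (H x y rfl rfl) (hgr _ _ hn'))
    · exact hr.1 x (H x x rfl (Quotient.sound (s := ⟨E, h⟩) ((hE x y).2 ⟨hn, hn'⟩)))
  · intro H x' y' hx hy
    have hx : E x' x := Quotient.exact (s := ⟨E, h⟩) hx
    have hy : E y' y := Quotient.exact (s := ⟨E, h⟩) hy
    rw [hE] at hx hy
    exact hgr _ _ ((hw _ _ y' ((hw x y x' H).resolve_left hx.2)).resolve_right hy.1)

theorem quotientLT_isLinear_isDense (hg : IsStrictPartial g) (hr : IsLinear r)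
    (hw : ∀ x y z, g x y → g x z ∨ g z y) (hgr : ∀ x y, g x y → r x y)
    (hE : ∀ x y, E x y ↔ ¬ g x y ∧ ¬ g y x) (hd : IsDense g) (h : Equivalence E) :
    IsLinear (quotientLT r ⟨E, h⟩) ∧ IsDense (quotientLT r ⟨E, h⟩) := by
  have key := quotientLT_mk_iff hr hw hgr hE h
  refine ⟨⟨fun x => ?_, fun x y z => ?_, fun x y => ?_⟩, fun x y => ?_⟩
  · induction x using Quotient.inductionOn with | _ x
    rw [key]
    exact hg.1 x
  · induction x using Quotient.inductionOn with | _ x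
    induction y using Quotient.inductionOn with | _ y
    induction z using Quotient.inductionOn with | _ z
    rw [key, key, key]
    exact hg.2 x y z
  · induction x using Quotient.inductionOn with | _ x
    induction y using Quotient.inductionOn with | _ y
    rw [key, key]
    by_cases h₁ : g x y
    · exact Or.inl h₁
    by_cases h₂ : g y x
    · exact Or.inr (Or.inr h₂)
    exact Or.inr (Or.inl (Quotient.sound (s := ⟨E, h⟩) ((hE x y).2 ⟨h₁, h₂⟩)))
  · induction x using Quotient.inductionOn with | _ x
    induction y using Quotient.inductionOn with | _ y
    rw [key]
    intro H
    obtain ⟨z, h₁, h₂⟩ := hd x y H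
    exact ⟨Quotient.mk _ z, (key x z).2 h₁, (key z y).2 h₂⟩

end Orders

/-! ### The order on the realizations of a family. -/

section Families

variable {S : Type u} {L : SortedLanguage.{u, v, w} S} {M : S → Type m} [L.Str M]
variable {A : Set (Σ s, M s)}

/-- The complete type of a pair. -/
def TypeWithRel.key (P : TypeWithRel L A) : Σ x, CompleteType L A x := ⟨P.ctx, P.typ⟩

theorem TypeWithRel.key_eq_of_mem_locus {P Q : TypeWithRel L A} {a : Tup M P.ctx.2}
    {b : Tup M Q.ctx.2} (ha : a ∈ P.typ.locus) (hb : b ∈ Q.typ.locus)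
    (h : (⟨P.ctx, a⟩ : Σ x : Ctx S, Tup M x.2) = ⟨Q.ctx, b⟩) : P.key = Q.key := by
  obtain ⟨x, p, r⟩ := P
  obtain ⟨y, q, s⟩ := Q
  cases h
  have : p.formulas = q.formulas :=
    (CompleteType.tp_eq_formulas ha).symm.trans (CompleteType.tp_eq_formulas hb)
  obtain ⟨p, _, _, _⟩ := p
  obtain ⟨q, _, _, _⟩ := q
  cases this
  rfl

open TypeWithRel

variable {F : Set (TypeWithRel L A)}

theorem exists_eq_toRealization (X : realizations F) :
    ∃ (P : TypeWithRel L A) (hP : P ∈ F) (a : P.typ.locus), X = toRealization hP a := by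
  obtain ⟨X, P, hP, a, ha, rfl⟩ := X
  exact ⟨P, hP, ⟨a, ha⟩, rfl⟩

/-- Several pairs of `F` may share the type of `b`. The choice does not matter, since right
genericity of `b` over `a` for any of them amounts to left genericity of `a` over `b`. -/
theorem genericLT_iff (hδ : ∀ P ∈ F, ∀ Q ∈ F, DirectlyNonorthogonal P Q)
    {P Q : TypeWithRel L A} (hP : P ∈ F) (hQ : Q ∈ F) (a : P.typ.locus) (b : Q.typ.locus) :
    genericLT F (toRealization hP a) (toRealization hQ b) ↔ Q.RightGeneric a.1.elems b.1 := by
  constructor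
  · rintro ⟨R, hR, c, hc, h, hg⟩
    have h : (⟨Q.ctx, b.1⟩ : Σ x : Ctx S, Tup M x.2) = ⟨R.ctx, c⟩ := h
    have h₁ : P.LeftGeneric b.1.elems a.1 ↔ P.LeftGeneric c.elems a.1 :=
      iff_of_eq (congrArg (fun z : Σ x : Ctx S, Tup M x.2 => P.LeftGeneric z.2.elems a.1) h)
    exact ((hδ P hP Q hQ).2 a.1 a.2 b.1 b.2).1.1
      (h₁.2 (((hδ P hP R hR).2 a.1 a.2 c hc).1.2 hg))
  · intro h
    exact ⟨Q, hQ, b.1, b.2, rfl, h⟩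

section Generic

variable (hM : Saturated L M) [Infinite (Σ s, M s)] (hA : Small A)
  (hF : ∀ P ∈ F, P.IsSoPair) (hδ : ∀ P ∈ F, ∀ Q ∈ F, DirectlyNonorthogonal P Q)

include hM hA hF hδ in
theorem genericLT_isStrictPartial : IsStrictPartial (genericLT F) := by
  refine ⟨fun X => ?_, fun X Y Z => ?_⟩
  · obtain ⟨P, hP, a, rfl⟩ := exists_eq_toRealization X
    rw [genericLT_iff hδ]
    exact fun h => (hF P hP).2.1.1 a ((hF P hP).lt_of_rightGeneric hM hA (hδ P hP P hP) h)
  · obtain ⟨P, hP, a, rfl⟩ := exists_eq_toRealization X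
    obtain ⟨Q, hQ, b, rfl⟩ := exists_eq_toRealization Y
    obtain ⟨R, hR, c, rfl⟩ := exists_eq_toRealization Z
    rw [genericLT_iff hδ, genericLT_iff hδ, genericLT_iff hδ]
    exact (hF Q hQ).rightGeneric_trans hM hA (hF R hR) (hδ Q hQ R hR)

include hM hA hF hδ in
theorem genericLT_isDense : IsDense (genericLT F) := by
  intro X Y
  obtain ⟨P, hP, a, rfl⟩ := exists_eq_toRealization X
  obtain ⟨Q, hQ, b, rfl⟩ := exists_eq_toRealization Y
  rw [genericLT_iff hδ]
  intro h
  obtain ⟨c, hc, hc'⟩ := (hF P hP).exists_rightGeneric_between hM hA (hF Q hQ) h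
  refine ⟨toRealization hP ⟨c, (hF P hP).mem_locus hc⟩, ?_, ?_⟩ <;> rw [genericLT_iff hδ]
  · exact hc
  · exact hc'

include hM hA hF hδ in
-- Interpolating `c'` of the type of `Z` reduces the claim to comparing `Z` with `c'` in one locus:
-- below `c'` left genericity over `Y` persists, above it right genericity over `X`.
theorem genericLT_or_genericLT (X Y Z : realizations F) (h : genericLT F X Y) :
    genericLT F X Z ∨ genericLT F Z Y := by
  obtain ⟨P, hP, a, rfl⟩ := exists_eq_toRealization X
  obtain ⟨Q, hQ, b, rfl⟩ := exists_eq_toRealization Y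
  obtain ⟨R, hR, c, rfl⟩ := exists_eq_toRealization Z
  rw [genericLT_iff hδ] at *
  rw [genericLT_iff hδ]
  obtain ⟨c', hac', hbc'⟩ := (hF R hR).exists_rightGeneric_between hM hA (hF Q hQ) h
  have hc' := (hF R hR).mem_locus hac'
  have hd := fun c (hc : c ∈ R.typ.locus) => ((hδ R hR Q hQ).2 c hc b.1 b.2).1
  rcases (hF R hR).2.1.2.2 c ⟨c', hc'⟩ with h' | h' | h'
  · exact Or.inr ((hd c.1 c.2).1 ((hF R hR).leftGeneric_of_lt hM
      (hA.union_finite b.1.finite_elems) (c := ⟨c', hc'⟩) ((hd c' hc').2 hbc') h'))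
  · subst h'
    exact Or.inl hac'
  · exact Or.inl ((hF R hR).rightGeneric_of_lt hM
      (hA.union_finite a.1.finite_elems) (c := ⟨c', hc'⟩) hac' h')

include hM hA hF hδ in
-- Both comparisons are rewritten as genericity of `X` over `Y`, where `IsSoPair.indep_iff` applies.
theorem forkingDep_iff (X Y : realizations F) :
    forkingDep F X Y ↔ ¬ genericLT F X Y ∧ ¬ genericLT F Y X := by
  obtain ⟨P, hP, a, rfl⟩ := exists_eq_toRealization X
  obtain ⟨Q, hQ, b, rfl⟩ := exists_eq_toRealization Y
  rw [genericLT_iff hδ, genericLT_iff hδ, ← ((hδ P hP Q hQ).2 a.1 a.2 b.1 b.2).1]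
  have := (hF P hP).indep_iff hM hA (hδ P hP P hP) (b := b.1) a.2
  refine (not_congr this).trans ?_
  rw [not_or, and_comm]

include hM hA hF in
theorem genericLT_isInvariant : IsInvariant F (genericLT F) := by
  have key : ∀ (x y : Ctx S) (a a' : Tup M x.2) (b b' : Tup M y.2)
      (ha : ⟨x, a⟩ ∈ realizations F) (ha' : ⟨x, a'⟩ ∈ realizations F)
      (hb : ⟨y, b⟩ ∈ realizations F) (hb' : ⟨y, b'⟩ ∈ realizations F),
      ElemEquiv L A (a.append b) (a'.append b') →
        genericLT F ⟨⟨x, a⟩, ha⟩ ⟨⟨y, b⟩, hb⟩ → genericLT F ⟨⟨x, a'⟩, ha'⟩ ⟨⟨y, b'⟩, hb'⟩ := by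
    rintro x y a a' b b' ha ha' hb hb' h ⟨P, hP, c, hc, hbc, hg⟩
    cases hbc
    exact ⟨P, hP, b', CompleteType.mem_locus_of_elemEquiv hc h.snd, rfl,
      (hF P hP).rightGeneric_congr hM hA h.swap hg⟩
  intro x y a a' b b' ha ha' hb hb' h
  exact ⟨key x y a a' b b' ha ha' hb hb' h, key x y a' a b' b ha' ha hb' hb h.symm⟩

end Generic

/-- The order of the pair `P`, as a relation on `𝓕(M)`. -/
def pairLT (F : Set (TypeWithRel L A)) (P : TypeWithRel L A) (X Y : realizations F) : Prop :=
  ∃ a b : P.typ.locus, X.1 = ⟨P.ctx, a.1⟩ ∧ Y.1 = ⟨P.ctx, b.1⟩ ∧ P.lt a b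

theorem pairLT_iff {P : TypeWithRel L A} {X Y : realizations F} {a b : P.typ.locus}
    (hX : X.1 = ⟨P.ctx, a.1⟩) (hY : Y.1 = ⟨P.ctx, b.1⟩) : pairLT F P X Y ↔ P.lt a b := by
  constructor
  · rintro ⟨a', b', hX', hY', h⟩
    have ha : a = a' := Subtype.ext (eq_of_heq (Sigma.mk.inj_iff.1 (hX.symm.trans hX')).2)
    have hb : b = b' := Subtype.ext (eq_of_heq (Sigma.mk.inj_iff.1 (hY.symm.trans hY')).2)
    rwa [ha, hb]
  · exact fun h => ⟨a, b, hX, hY, h⟩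

/-- `sel` chooses from `F` one pair for each complete type that appears in `F`. -/
structure IsTypeSelector (F : Set (TypeWithRel L A)) (sel : TypeWithRel L A → TypeWithRel L A) :
    Prop where
  mem : ∀ P ∈ F, sel P ∈ F
  key_eq : ∀ P ∈ F, (sel P).key = P.key
  eq_of_key_eq : ∀ P ∈ F, ∀ Q ∈ F, P.key = Q.key → sel P = sel Q

theorem exists_isTypeSelector {I : Type*} (P : I → TypeWithRel L A) (hP : ∀ i, P i ∈ F)
    (hinj : ∀ i j, i ≠ j → (P i).key ≠ (P j).key) :
    ∃ sel, IsTypeSelector F sel ∧ ∀ i, sel (P i) = P i := by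
  classical
  -- Choosing per type rather than per pair makes the selection depend on the type alone; a
  -- prescribed `P i` takes precedence, unambiguously because the prescribed types are distinct.
  have : ∀ k : Σ x, CompleteType L A x, (∃ Q ∈ F, Q.key = k) →
      ∃ Q ∈ F, Q.key = k ∧ ∀ i, (P i).key = k → Q = P i := by
    rintro k ⟨Q, hQ, hk⟩
    by_cases h : ∃ i, (P i).key = k
    · obtain ⟨i, hi⟩ := h
      refine ⟨P i, hP i, hi, fun j hj => congrArg P ?_⟩
      by_contra hn
      exact hinj i j hn (hi.trans hj.symm)
    · exact ⟨Q, hQ, hk, fun i hi => (h ⟨i, hi⟩).elim⟩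
  choose f hfF hfk hfP using this
  have hf : ∀ k k' h h', k = k' → f k h = f k' h' := by
    rintro k _ h h' rfl
    rfl
  -- The value outside `F` is a default that is never used.
  refine ⟨fun Q => if h : Q ∈ F then f Q.key ⟨Q, h, rfl⟩ else Q,
    ⟨fun Q hQ => ?_, fun Q hQ => ?_, fun Q hQ Q' hQ' h => ?_⟩, fun i => ?_⟩
  · simp only [dif_pos hQ]
    exact hfF _ _
  · simp only [dif_pos hQ]
    exact hfk _ _
  · simp only [dif_pos hQ, dif_pos hQ']
    exact hf _ _ _ _ h
  · simp only [dif_pos (hP i)]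
    exact hfP _ _ i rfl

/-- The selected pair whose type is the type of `X`. -/
noncomputable def selected (sel : TypeWithRel L A → TypeWithRel L A) (X : realizations F) :
    TypeWithRel L A :=
  sel (exists_eq_toRealization X).choose

section Selected

variable {sel : TypeWithRel L A → TypeWithRel L A} (hsel : IsTypeSelector F sel)

include hsel in
-- The pair picked by `choose` is arbitrary, but it has the type of `X`, and the selector sees only
-- the type.
theorem selected_eq {P : TypeWithRel L A} (hP : P ∈ F) {X : realizations F} {a : P.typ.locus}
    (hX : X.1 = ⟨P.ctx, a.1⟩) : selected sel X = sel P := by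
  obtain ⟨hQ, b, hb⟩ := (exists_eq_toRealization X).choose_spec
  exact hsel.eq_of_key_eq _ hQ _ hP
    (key_eq_of_mem_locus b.2 a.2 ((congrArg Subtype.val hb).symm.trans hX))

include hsel in
theorem exists_selected (X : realizations F) :
    selected sel X ∈ F ∧ ∃ a : (selected sel X).typ.locus,
      X.1 = ⟨(selected sel X).ctx, a.1⟩ := by
  obtain ⟨P, hP, a, rfl⟩ := exists_eq_toRealization X
  rw [selected_eq hsel hP (a := a) rfl]
  refine ⟨hsel.mem P hP, ?_⟩
  have key : ∀ Q : TypeWithRel L A, Q.key = P.key →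
      ∃ b : Q.typ.locus, (⟨P.ctx, a.1⟩ : Σ x : Ctx S, Tup M x.2) = ⟨Q.ctx, b.1⟩ := by
    rintro ⟨x, q, s⟩ h
    obtain ⟨y, p, r⟩ := P
    cases h
    exact ⟨a, rfl⟩
  exact key _ (hsel.key_eq P hP)

/-- Elements of different types are compared by their types, elements of the same type by the
order of the selected pair. -/
def baseLT (sel : TypeWithRel L A → TypeWithRel L A) (X Y : realizations F) : Prop :=
  WellOrderingRel (selected sel X) (selected sel Y) ∨
    selected sel X = selected sel Y ∧ pairLT F (selected sel X) X Y

include hsel in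
theorem baseLT_isLinear (hF : ∀ P ∈ F, P.IsSoPair) : IsLinear (baseLT (F := F) sel) := by
  refine ⟨fun X => ?_, fun X Y Z => ?_, fun X Y => ?_⟩
  · obtain ⟨hP, a, ha⟩ := exists_selected hsel X
    rintro (h | ⟨-, h⟩)
    · exact irrefl_of WellOrderingRel _ h
    · exact (hF _ hP).2.1.1 a ((pairLT_iff ha ha).1 h)
  · rintro (h | ⟨h, h'⟩) (k | ⟨k, k'⟩)
    · exact Or.inl (trans_of WellOrderingRel h k)
    · exact Or.inl (k ▸ h)
    · exact Or.inl (h.symm ▸ k)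
    · refine Or.inr ⟨h.trans k, ?_⟩
      have hP := (exists_selected hsel X).1
      rw [← h] at k'
      obtain ⟨a, b, ha, hb, hab⟩ := h'
      obtain ⟨b', c, hb', hc, hbc⟩ := k'
      have hbb : b = b' := Subtype.ext (eq_of_heq (Sigma.mk.inj_iff.1 (hb.symm.trans hb')).2)
      subst hbb
      exact ⟨a, c, ha, hc, (hF _ hP).2.1.2.1 _ _ _ hab hbc⟩
  · rcases trichotomous_of WellOrderingRel (selected sel X) (selected sel Y) with h | h | h
    · exact Or.inl (Or.inl h)
    · obtain ⟨hP, a, ha⟩ := exists_selected hsel X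
      have hY := (exists_selected hsel Y).2
      rw [← h] at hY
      obtain ⟨b, hb⟩ := hY
      rcases (hF _ hP).2.1.2.2 a b with h' | rfl | h'
      · exact Or.inl (Or.inr ⟨h, a, b, ha, hb, h'⟩)
      · exact Or.inr (Or.inl (Subtype.ext (ha.trans hb.symm)))
      · refine Or.inr (Or.inr (Or.inr ⟨h.symm, ?_⟩))
        rw [← h]
        exact ⟨b, a, hb, ha, h'⟩
    · exact Or.inr (Or.inr (Or.inl h))

include hsel in
theorem selected_eq_of_elemEquiv {x : Ctx S} {a a' : Tup M x.2} (ha : ⟨x, a⟩ ∈ realizations F)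
    (ha' : ⟨x, a'⟩ ∈ realizations F) (h : ElemEquiv L A a a') :
    selected sel ⟨⟨x, a⟩, ha⟩ = selected sel ⟨⟨x, a'⟩, ha'⟩ := by
  obtain ⟨P, hP, b, hb, hab⟩ := id ha
  cases hab
  rw [selected_eq hsel hP (a := ⟨_, hb⟩) rfl, selected_eq hsel hP
    (a := ⟨a', CompleteType.mem_locus_of_elemEquiv hb h⟩) rfl]

include hsel in
theorem baseLT_isInvariant (hF : ∀ P ∈ F, P.IsSoPair) : IsInvariant F (baseLT sel) := by
  intro x y a a' b b' ha ha' hb hb' h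
  have h₁ := selected_eq_of_elemEquiv hsel ha ha' h.fst
  have h₂ := selected_eq_of_elemEquiv hsel hb hb' h.snd
  unfold baseLT
  rw [h₁, h₂]
  refine or_congr Iff.rfl (and_congr_right fun _ => ?_)
  have hP := (exists_selected hsel ⟨⟨x, a'⟩, ha'⟩).1
  generalize selected sel ⟨⟨x, a'⟩, ha'⟩ = P at hP
  have key : ∀ (a a' : Tup M x.2) (b b' : Tup M y.2) ha ha' hb hb',
      ElemEquiv L A (a.append b) (a'.append b') →
      pairLT F P ⟨⟨x, a⟩, ha⟩ ⟨⟨y, b⟩, hb⟩ → pairLT F P ⟨⟨x, a'⟩, ha'⟩ ⟨⟨y, b'⟩, hb'⟩ := by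
    rintro a a' b b' ha ha' hb hb' h ⟨c, d, hc, hd, hcd⟩
    obtain ⟨c, hcl⟩ := c
    obtain ⟨d, hdl⟩ := d
    cases hc
    cases hd
    exact ⟨⟨a', CompleteType.mem_locus_of_elemEquiv hcl h.fst⟩,
      ⟨b', CompleteType.mem_locus_of_elemEquiv hdl h.snd⟩, rfl, rfl, ((hF P hP).1.lt_congr h).1 hcd⟩
  exact ⟨key a a' b b' ha ha' hb hb' h, key a' a b' b ha' ha hb' hb h.symm⟩

end Selected

/-- The linear extension of `◁` determined by a choice of pairs for the types that appear
in `F`. -/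
def adequateLT (sel : TypeWithRel L A → TypeWithRel L A) (X Y : realizations F) : Prop :=
  genericLT F X Y ∨ ¬ genericLT F Y X ∧ baseLT sel X Y

section Adequate

variable (hM : Saturated L M) [Infinite (Σ s, M s)] (hA : Small A)
  (hF : ∀ P ∈ F, P.IsSoPair) (hδ : ∀ P ∈ F, ∀ Q ∈ F, DirectlyNonorthogonal P Q)
  {sel : TypeWithRel L A → TypeWithRel L A} (hsel : IsTypeSelector F sel)

include hM hA hF hδ hsel

theorem adequateLT_isLinear : IsLinear (adequateLT (F := F) sel) :=
  isLinear_refinement (genericLT_isStrictPartial hM hA hF hδ)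
    (genericLT_or_genericLT hM hA hF hδ) (baseLT_isLinear hsel hF)

/-- On the locus `◁` is contained in the order of `P`, so refining never contradicts that order; the
converse follows from linearity. -/
theorem adequateLT_iff_lt {P : TypeWithRel L A} (hP : P ∈ F) (h : sel P = P)
    (a b : P.typ.locus) :
    adequateLT sel (toRealization hP a) (toRealization hP b) ↔ P.lt a b := by
  have hmono : ∀ {a b : P.typ.locus}, P.lt a b →
      adequateLT sel (toRealization hP a) (toRealization hP b) := by
    intro a b hab
    refine Or.inr ⟨?_, Or.inr ⟨?_, ?_⟩⟩
    · rw [genericLT_iff hδ]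
      exact fun hg => (hF P hP).2.1.1 a ((hF P hP).2.1.2.1 _ _ _ hab
        ((hF P hP).lt_of_rightGeneric hM hA (hδ P hP P hP) hg))
    · rw [selected_eq hsel hP (a := a) rfl, selected_eq hsel hP (a := b) rfl]
    · rw [selected_eq hsel hP (a := a) rfl, h]
      exact ⟨a, b, rfl, rfl, hab⟩
  refine ⟨fun hab => ?_, hmono⟩
  have hlin := adequateLT_isLinear hM hA hF hδ hsel
  rcases (hF P hP).2.1.2.2 a b with h' | rfl | h'
  · exact h'
  · exact (hlin.1 _ hab).elim
  · exact (hlin.1 _ (hlin.2.1 _ _ _ hab (hmono h'))).elim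

/-- The restriction is thus itself a member of `F`, from which the so-pair and nonorthogonality
clauses are read off. -/
theorem restrictTo_adequateLT {P : TypeWithRel L A} (hP : P ∈ F) :
    restrictTo (adequateLT sel) hP = sel P := by
  have hQ := hsel.mem P hP
  have hkey := hsel.key_eq P hP
  have hlt := adequateLT_iff_lt hM hA hF hδ hsel hQ
    (hsel.eq_of_key_eq _ hQ _ hP hkey)
  generalize sel P = Q at hQ hkey hlt
  obtain ⟨x, p, r⟩ := P
  obtain ⟨y, q, s⟩ := Q
  cases hkey
  have : (fun a b => adequateLT sel (toRealization hP a) (toRealization hP b)) = s :=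
    funext fun a => funext fun b => propext (hlt a b)
  exact congrArg (TypeWithRel.mk x p) this

theorem adequateLT_isAdequateOrder : IsAdequateOrder F (adequateLT sel) := by
  have hg := genericLT_isStrictPartial hM hA hF hδ
  have hw := genericLT_or_genericLT hM hA hF hδ
  have hE := forkingDep_iff hM hA hF hδ
  have hlin := adequateLT_isLinear hM hA hF hδ hsel
  have hext : ∀ X Y, genericLT F X Y → adequateLT sel X Y := fun X Y h => Or.inl h
  have hmem : ∀ (P : TypeWithRel L A) (hP : P ∈ F), restrictTo (adequateLT sel) hP ∈ F := by
    intro P hP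
    rw [restrictTo_adequateLT hM hA hF hδ hsel]
    exact hsel.mem P hP
  exact {
    linear := hlin
    invariant := by
      have h₁ := genericLT_isInvariant hM hA hF
      have h₂ := baseLT_isInvariant hsel hF
      intro x y a a' b b' ha ha' hb hb' h
      exact or_congr (h₁ x y a a' b b' ha ha' hb hb' h)
        (and_congr (not_congr (h₁ y x b b' a a' hb hb' ha ha' h.swap))
          (h₂ x y a a' b b' ha ha' hb hb' h))
    genericLT_partial := hg
    extends_genericLT := hext
    dep_iff_incomparable := hE
    dep_convex := hasConvexClasses_of_iff_incomparable hlin hw hext hE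
    quotient_dense := ⟨equivalence_of_iff_incomparable hg hw hE,
      quotientLT_isLinear_isDense hg hlin hw hext hE (genericLT_isDense hM hA hF hδ) _⟩
    restrict_definable := fun P hP => (hF _ (hmem P hP)).1
    restrict_soPair := fun P hP => hF _ (hmem P hP)
    restrict_direct := fun P hP Q hQ => hδ _ (hmem P hP) Q hQ
    substructure_genericLT := fun P hP a b =>
      (genericLT_iff hδ (hmem P hP) (hmem P hP) a b).symm
    substructure_dep := fun P hP a b => Iff.rfl }

end Adequate

/-- An infinite universe is what keeps a small set small after a finite tuple is added. -/
theorem CompleteType.NonAlgebraic.infinite {x : Ctx S} {p : CompleteType L A x}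
    (h : p.NonAlgebraic) : Infinite (Σ s, M s) := by
  by_contra hfin
  rw [not_infinite_iff_finite] at hfin
  have : Finite (Tup M x.2) :=
    Finite.of_injective (fun (a : Tup M x.2) i => (⟨x.2 i, a i⟩ : Σ s, M s)) fun a b hab =>
      funext fun i => eq_of_heq (Sigma.mk.inj_iff.1 (congrFun hab i)).2
  obtain ⟨φ, hφ, -⟩ : DefOver L A (Set.univ : Set (Tup M x.2)) := DefOver.univ
  rcases p.complete φ hφ with h' | h'
  · exact h _ h' (Set.toFinite _)
  · exact h _ h' (Set.toFinite _)

/-- An empty family has no non-algebraic type to witness that the universe is infinite, so it is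
treated apart. -/
theorem isAdequateOrder_of_isEmpty [IsEmpty (realizations F)]
    (hF : ∀ P, P ∉ F) : IsAdequateOrder F fun _ _ => False where
  linear := ⟨isEmptyElim, isEmptyElim, isEmptyElim⟩
  invariant := fun _ _ _ _ _ _ _ _ _ _ _ => Iff.rfl
  genericLT_partial := ⟨isEmptyElim, isEmptyElim⟩
  extends_genericLT := isEmptyElim
  dep_iff_incomparable := isEmptyElim
  dep_convex := isEmptyElim
  quotient_dense := ⟨⟨isEmptyElim, fun {x} => isEmptyElim x, fun {x} => isEmptyElim x⟩,
    ⟨fun x => Quotient.inductionOn x isEmptyElim, fun x => Quotient.inductionOn x isEmptyElim,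
      fun x => Quotient.inductionOn x isEmptyElim⟩, fun x => Quotient.inductionOn x isEmptyElim⟩
  restrict_definable := fun P hP => (hF P hP).elim
  restrict_soPair := fun P hP => (hF P hP).elim
  restrict_direct := fun P hP => (hF P hP).elim
  substructure_genericLT := fun P hP => (hF P hP).elim
  substructure_dep := fun P hP => (hF P hP).elim

theorem exists_isAdequateOrder_extending (hM : Saturated L M) (hA : Small A)
    (hF : ∃ P₀ : TypeWithRel L A, P₀.IsSoPair ∧ F ⊆ deltaClass P₀)
    (hna : ∀ P ∈ F, P.typ.NonAlgebraic) {I : Type*} (P : I → TypeWithRel L A)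
    (hP : ∀ i, P i ∈ F) (hinj : ∀ i j, i ≠ j → (P i).key ≠ (P j).key) :
    ∃ r, IsAdequateOrder F r ∧ ∀ (i : I) (a b : (P i).typ.locus), (P i).lt a b →
      r (toRealization (hP i) a) (toRealization (hP i) b) := by
  rcases F.eq_empty_or_nonempty with rfl | ⟨Q, hQ⟩
  · have : IsEmpty (realizations (∅ : Set (TypeWithRel L A))) :=
      ⟨fun ⟨_, _, h, _⟩ => h⟩
    exact ⟨_, isAdequateOrder_of_isEmpty fun P h => h, fun i => (hP i).elim⟩
  · have := (hna Q hQ).infinite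
    obtain ⟨P₀, hP₀, hFP₀⟩ := hF
    have hF : ∀ P ∈ F, P.IsSoPair := fun P hP => (hFP₀ hP).1
    have hδ : ∀ P ∈ F, ∀ Q ∈ F, DirectlyNonorthogonal P Q := fun P hP Q hQ =>
      (hFP₀ hP).2.symm.trans hM hA (hF P hP) hP₀ (hF Q hQ) (hFP₀ hQ).2
    obtain ⟨sel, hsel, hselP⟩ := exists_isTypeSelector P hP hinj
    exact ⟨adequateLT sel, adequateLT_isAdequateOrder hM hA hF hδ hsel, fun i a b h =>
      (adequateLT_iff_lt hM hA hF hδ hsel (hP i) (hselP i) a b).2 h⟩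

end Families

end SortedLanguage

theorem theorem5 {S : Type*} (L : SortedLanguage S) (M : S → Type*) [L.Str M]
    (hM : SortedLanguage.Saturated L M)
    (A : Set (Σ s, M s)) (hA : SortedLanguage.Small A)
    (F : Set (SortedLanguage.TypeWithRel L A))
    (hF : ∃ P₀ : SortedLanguage.TypeWithRel L A,
      P₀.IsSoPair ∧ F ⊆ SortedLanguage.deltaClass P₀)
    (hna : ∀ P ∈ F, P.typ.NonAlgebraic) :
    (∃ r, SortedLanguage.IsAdequateOrder F r) ∧
    ∀ (I : Type*) (P : I → SortedLanguage.TypeWithRel L A) (hP : ∀ i, P i ∈ F),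
      (∀ i j, i ≠ j →
        (⟨(P i).ctx, (P i).typ⟩ : Σ x, SortedLanguage.CompleteType L A x) ≠
          ⟨(P j).ctx, (P j).typ⟩) →
      ∃ r, SortedLanguage.IsAdequateOrder F r ∧
        ∀ (i : I) (a b : (P i).typ.locus), (P i).lt a b →
          r (SortedLanguage.toRealization (hP i) a) (SortedLanguage.toRealization (hP i) b) := by
  refine ⟨?_, fun I P hP hinj =>
    SortedLanguage.exists_isAdequateOrder_extending hM hA hF hna P hP hinj⟩
  -- Bare existence is the case of an empty family of prescribed orders.
  obtain ⟨r, hr, -⟩ := SortedLanguage.exists_isAdequateOrder_extending hM hA hF hna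
    (I := Empty) (fun i => i.elim) (fun i => i.elim) (fun i => i.elim)
  exact ⟨r, hr⟩
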